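/- Consider $N\ge 1$ spins with Hamiltonian $H(t)=H_{\rm Ising}-\Gamma(t)\sum_{i=1}^N\sigma_i^x$, $t\ge 0$, where $H_{\rm Ising}$ is an arbitrary real linear combination of products of the $\sigma^z_i$ with $\|H_{\rm Ising}\|\le CN$ in operator norm, and $\Gamma(t)=(\delta t+c)^{-g(t)}$ with $\delta,c>0$ and $g$ twice differentiable on $[0,\infty)$. Let $L,l,c',c''$ be positive constants, where $L$ may depend on $N$ and $L<\frac1{3N-2}$, and suppose that for all $t\ge 0$ $$0<g(t)\le L,\qquad |g'(t)|\le\frac{\delta c'}{(\delta t+c)^{1+l}},\qquad |g''(t)|\,|\log(\delta t+c)|\le\delta^2c''(\delta t+c)^{-1-\frac{2N-1}{3N-2}}.$$ Let $\psi$ solve the Schrödinger equation $i\,\psi'(t)=H(t)\psi(t)$ on $[0,\infty)$, where $\psi(0)$ is a normalized ground state of $H(0)$; let $P_\tau(t)=|\psi(t)\rangle\langle\psi(t)|$, let $P(t)=|0(t)\rangle\langle 0(t)|$ be the projector onto the instantaneous ground state of $H(t)$, and let $\Delta(t)$ be the gap between the two lowest eigenvalues of $H(t)$, counted with multiplicity.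 There are constants $a,b>0$ depending only on $C$ and $c$, and $\kappa>0$ depending only on $C,c,l,c',c''$ (so none of them depends on $N$), such that, for all such data: (i) $\Delta(t)\ge a\sqrt N\,e^{-bN}\,\Gamma(t)^N$ for all $t\ge0$; (ii) the limit $P_{\rm excited}=\lim_{t\to\infty}\|P_\tau(t)-P(t)\|$ exists, and for every $\varepsilon>0$ $$\delta\le\kappa\,\varepsilon\,\bigl(1-(3N-2)L\bigr)\,N^{-1/2}e^{-3bN}\quad\Longrightarrow\quad P_{\rm excited}\le\varepsilon .$$ In particular, for fixed $N$ the infinite-time excitation measure $P_{\rm excited}$ becomes arbitrarily small when $\delta$ is a small constant times $N^{-1/2}e^{-3bN}$. -/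

import Mathlib

open Filter Topology Set

noncomputable section

namespace QuantumAnnealing

/-- The computational basis of `N` spins: `0` is spin up, `1` is spin down. -/
abbrev Config (N : ℕ) : Type := Fin N → Fin 2

/-- The `2 ^ N`-dimensional Hilbert space of `N` spins. -/
abbrev SpinSpace (N : ℕ) : Type := EuclideanSpace ℂ (Config N)

/-- The Pauli matrix `σ^x`. -/
def pauliX : Matrix (Fin 2) (Fin 2) ℂ := !![0, 1; 1, 0]

/-- The Pauli matrix `σ^z`. -/
def pauliZ : Matrix (Fin 2) (Fin 2) ℂ := !![1, 0; 0, -1]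

/-- The tensor product `A 0 ⊗ A 1 ⊗ ⋯ ⊗ A (N - 1)` of single-spin operators, in the computational
basis. -/
def tensorOp {N : ℕ} (A : Fin N → Matrix (Fin 2) (Fin 2) ℂ) : Matrix (Config N) (Config N) ℂ :=
  Matrix.of fun s s' => ∏ i, A i (s i) (s' i)

/-- `σ^x` acting on the spin at site `i`. -/
def sigmaX {N : ℕ} (i : Fin N) : Matrix (Config N) (Config N) ℂ :=
  tensorOp fun j => if j = i then pauliX else 1

/-- The product of the operators `σ^z` at the sites in `S`. -/
def sigmaZ {N : ℕ} (S : Finset (Fin N)) : Matrix (Config N) (Config N) ℂ :=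
  tensorOp fun j => if j ∈ S then pauliZ else 1

/-- The operator on the Hilbert space given by a matrix in the computational basis. -/
def op {N : ℕ} (M : Matrix (Config N) (Config N) ℂ) : SpinSpace N →L[ℂ] SpinSpace N :=
  Matrix.toEuclideanCLM (n := Config N) (𝕜 := ℂ) M

/-- The Ising Hamiltonian with arbitrary real many-body couplings `J S`, one for each set `S` of
sites (since `σ^z` squares to the identity, repeated sites give nothing new; the empty set
contributes an additive constant). -/
def isingHamiltonian {N : ℕ} (J : Finset (Fin N) → ℝ) : SpinSpace N →L[ℂ] SpinSpace N :=
  -∑ S : Finset (Fin N), (J S : ℂ) • op (sigmaZ S)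

/-- The transverse-field Ising Hamiltonian with transverse field of strength `γ`. -/
def hamiltonian {N : ℕ} (J : Finset (Fin N) → ℝ) (γ : ℝ) : SpinSpace N →L[ℂ] SpinSpace N :=
  isingHamiltonian J - (γ : ℂ) • ∑ i : Fin N, op (sigmaX i)

/-- `φ` is a normalized eigenvector of `H` for the eigenvalue `E`, and `E` is the smallest
real eigenvalue of `H`. -/
def IsGroundState {N : ℕ} (H : SpinSpace N →L[ℂ] SpinSpace N) (E : ℝ) (φ : SpinSpace N) : Prop :=
  ‖φ‖ = 1 ∧ H φ = (E : ℂ) • φ ∧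
    ∀ (E' : ℝ) (χ : SpinSpace N), χ ≠ 0 → H χ = (E' : ℂ) • χ → E ≤ E'

/-- The gap `ε₁ - ε₀` between the two lowest eigenvalues, counted with multiplicity: the least
difference between the energy of an eigenvector orthogonal to a ground state and the ground-state
energy. -/
def energyGap {N : ℕ} (H : SpinSpace N →L[ℂ] SpinSpace N) : ℝ :=
  sInf {d : ℝ | ∃ (E₀ E₁ : ℝ) (φ χ : SpinSpace N), IsGroundState H E₀ φ ∧ χ ≠ 0 ∧
    inner ℂ φ χ = 0 ∧ H χ = (E₁ : ℂ) • χ ∧ d = E₁ - E₀}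

/-- The operator `|φ⟩⟨φ|`, the orthogonal projector onto the line of `φ` if `φ` is normalized. -/
def proj {N : ℕ} (φ : SpinSpace N) : SpinSpace N →L[ℂ] SpinSpace N :=
  InnerProductSpace.rankOne ℂ φ φ

/-- `ψ` solves the Schrödinger equation `i dψ/dt = H(t) ψ` on `[0, ∞)`. -/
def SolvesSchrodinger {N : ℕ} (H : ℝ → SpinSpace N →L[ℂ] SpinSpace N) (ψ : ℝ → SpinSpace N) :
    Prop :=
  ∀ t : ℝ, 0 ≤ t → HasDerivWithinAt ψ (-Complex.I • H t (ψ t)) (Ici 0) t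

/-- The annealing schedule `Γ(t) = (δ t + c) ^ (-g(t))`. -/
def transverseField (δ c : ℝ) (g : ℝ → ℝ) (t : ℝ) : ℝ := (δ * t + c) ^ (-g t)

/-- The conditions on the exponent `g` for `N` spins: `g` is twice differentiable on `[0, ∞)` with
first and second derivatives `g₁` and `g₂` (one-sided at `0`), `0 < g ≤ L`, and `g₁`, `g₂` decay
as required. The bound on `g₂` is multiplied out by the logarithm. -/
structure AdmissibleExponent (N : ℕ) (L l c' c'' δ c : ℝ) (g g₁ g₂ : ℝ → ℝ) : Prop where
  hasDeriv : ∀ t : ℝ, 0 ≤ t → HasDerivWithinAt g (g₁ t) (Ici 0) t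
  hasDeriv₂ : ∀ t : ℝ, 0 ≤ t → HasDerivWithinAt g₁ (g₂ t) (Ici 0) t
  pos : ∀ t : ℝ, 0 ≤ t → 0 < g t
  le : ∀ t : ℝ, 0 ≤ t → g t ≤ L
  bound₁ : ∀ t : ℝ, 0 ≤ t → |g₁ t| ≤ δ * c' / (δ * t + c) ^ (1 + l)
  bound₂ : ∀ t : ℝ, 0 ≤ t → |g₂ t| * |Real.log (δ * t + c)| ≤
    δ ^ 2 * c'' * (δ * t + c) ^ (-1 - (2 * (N : ℝ) - 1) / (3 * (N : ℝ) - 2))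

end QuantumAnnealing

end

/-!
The proof has three parts: a gap bound, an adiabatic estimate, and the integrals along the schedule.

*Gap.* For a constant `K` proportional to `N` the matrix of `K - H(γ)` in the computational basis
has nonnegative entries, and it dominates `γ (N + ∑ i, σ^x_i)` entrywise. Counting the orders in
which the differing spins can be flipped, all entries of `(K - H) ^ N` are at least `N! γ ^ N`
(`le_shiftedMatrix_pow`). A symmetric matrix with all entries at least `m` has a gap of at least `m`
below its largest eigenvalue: some combination `w` of the top eigenvector and another one has
amplitudes summing to zero, so that `m` may be subtracted from all entries before `w` is replaced by
its moduli (`add_le_of_entries_ge`). Taking `N`-th roots and using `N! ≥ N ^ N e ^ (-N)` gives a gap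
`√N e ^ (-bN) γ ^ N` (`add_gapBound_le`). The rate `b = gapRate C M` is taken large enough to absorb
all powers of `N`. The ground state is thus nondegenerate, and as the off-diagonal entries of `H`
are nonpositive it can be chosen with nonnegative amplitudes (`exists_isGroundState_nonneg`). This
fixes its phase, and makes it orthogonal to its derivative.

*Adiabatic estimate.* Let `φ(γ)` be this ground state, with energy `E`, let `D` be the gap bound,
and let `X = ∑ i, σ^x_i`. First-order perturbation theory gives `φ' = R (X - e) φ` with the reduced
resolvent `R` and `e = ⟨φ, X φ⟩`, and the solution `ζ = R φ'` of `(H - E) ζ = φ'` is differentiable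
with `‖ζ‖ ≤ 2 ‖X‖ / D ^ 2` and `‖ζ'‖ ≤ 24 ‖X‖ ^ 2 / D ^ 3` (`IsGappedFamily.exists_corrector`). With
the dynamical phase `p` and `y = Γ' ζ(Γ)`, the vector `p (φ(Γ) + i y)` solves the Schrödinger
equation up to the source `i p y'`. Hence the distance of `ψ` from the line of `φ` is at most
`‖y‖` at both ends plus the integral of `‖y'‖`, and the overlap of `φ` and `ψ` converges in modulus
(`adiabatic_theorem`); the norm of the difference of the two projectors is a function of this
overlap (`norm_rankOne_sub_rankOne`).

*Schedule.* In terms of `x = δ t + c`, `S = 1 - (3N - 2) L` and `r = (2N - 1) / (3N - 2)`, the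
conditions on `g` bound `‖y'‖` by a constant times `δ ^ 2 √N e ^ (3bN) x ^ (-1 - r S)`
(`source_bound`), whose integral over time is of order `δ √N e ^ (3bN) / S` because `r ≥ 1 / 2`.
-/

namespace QuantumAnnealing

/-! ### Symmetric operators and their eigenbases -/

section Spectral

variable {V : Type*} [NormedAddCommGroup V] [InnerProductSpace ℂ V]

theorem exists_eigenbasis [FiniteDimensional ℂ V] {T : V →L[ℂ] V}
    (hT : (T : V →ₗ[ℂ] V).IsSymmetric) :
    ∃ (b : OrthonormalBasis (Fin (Module.finrank ℂ V)) ℂ V)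
      (μ : Fin (Module.finrank ℂ V) → ℝ), ∀ i, T (b i) = (μ i : ℂ) • b i :=
  ⟨hT.eigenvectorBasis rfl, hT.eigenvalues rfl, fun i => hT.apply_eigenvectorBasis rfl i⟩

theorem re_inner_ofReal_smul_self (v : V) (E : ℝ) :
    (inner ℂ v ((E : ℂ) • v)).re = E * ‖v‖ ^ 2 := by
  have h : inner ℂ v v = ((‖v‖ ^ 2 : ℝ) : ℂ) := by simp [inner_self_eq_norm_sq_to_K]
  rw [inner_smul_right, h, ← Complex.ofReal_mul, Complex.ofReal_re]

theorem inner_self_of_norm_eq_one {v : V} (hv : ‖v‖ = 1) : inner ℂ v v = (1 : ℂ) := by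
  simp [inner_self_eq_norm_sq_to_K, hv]

theorem re_inner_eq_sum_eigenbasis {ι : Type*} [Fintype ι] {T : V →L[ℂ] V}
    (hT : (T : V →ₗ[ℂ] V).IsSymmetric) (b : OrthonormalBasis ι ℂ V) {μ : ι → ℝ}
    (hb : ∀ i, T (b i) = (μ i : ℂ) • b i) (v : V) :
    (inner ℂ v (T v)).re = ∑ i, μ i * ‖inner ℂ (b i) v‖ ^ 2 := by
  rw [← b.sum_inner_mul_inner v (T v), Complex.re_sum]
  refine Finset.sum_congr rfl fun i _ => ?_
  have h1 : inner ℂ (b i) (T v) = (μ i : ℂ) * inner ℂ (b i) v := by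
    have := hT (b i) v
    simp only [ContinuousLinearMap.coe_coe] at this
    rw [← this, hb, inner_smul_left, Complex.conj_ofReal]
  have h2 : inner ℂ v (b i) * inner ℂ (b i) v = ((‖inner ℂ (b i) v‖ ^ 2 : ℝ) : ℂ) := by
    rw [← inner_conj_symm v (b i), mul_comm, Complex.mul_conj, Complex.normSq_eq_norm_sq]
  rw [h1, mul_left_comm, h2, ← Complex.ofReal_mul, Complex.ofReal_re]

/-- If every eigenvector orthogonal to the eigenvector `φ` has eigenvalue at least `E + D`, then
the eigenvalue `E` is simple and `T` is bounded below by `E + D` on the complement of `φ`. -/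
theorem coercive_of_eigenvector_gap [FiniteDimensional ℂ V] {T : V →L[ℂ] V}
    (hT : (T : V →ₗ[ℂ] V).IsSymmetric) {φ : V} {E D : ℝ} (hφ : ‖φ‖ = 1)
    (hE : T φ = (E : ℂ) • φ) (hD : 0 < D)
    (hgap : ∀ (E' : ℝ) (χ : V), χ ≠ 0 → inner ℂ φ χ = 0 → T χ = (E' : ℂ) • χ → E + D ≤ E')
    {y : V} (hy : inner ℂ φ y = 0) : (E + D) * ‖y‖ ^ 2 ≤ (inner ℂ y (T y)).re := by
  obtain ⟨b, μ, hb⟩ := exists_eigenbasis hT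
  rw [re_inner_eq_sum_eigenbasis hT b hb, ← b.sum_sq_norm_inner_right y, Finset.mul_sum]
  refine Finset.sum_le_sum fun i _ => ?_
  by_cases hi : E + D ≤ μ i
  · gcongr
  -- otherwise `b i` is a multiple of `φ`
  have hbi : b i ≠ 0 := b.orthonormal.ne_zero i
  have hsym : ((μ i : ℂ) - E) * inner ℂ φ (b i) = 0 := by
    have := hT φ (b i)
    simp only [ContinuousLinearMap.coe_coe, hE, hb, inner_smul_left, inner_smul_right,
      Complex.conj_ofReal] at this
    linear_combination -this
  have hne : inner ℂ φ (b i) ≠ 0 := fun h => hi (hgap _ _ hbi h (hb i))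
  have hμ : μ i = E := by
    have := (mul_eq_zero.1 hsym).resolve_right hne
    exact_mod_cast sub_eq_zero.1 this
  have hφφ : inner ℂ φ φ = (1 : ℂ) := inner_self_of_norm_eq_one hφ
  have hz : b i - inner ℂ φ (b i) • φ = 0 := by
    by_contra hz
    have := hgap E _ hz (by rw [inner_sub_right, inner_smul_right, hφφ]; simp)
      (by rw [map_sub, map_smul, hb, hE, hμ, smul_sub, smul_comm])
    linarith
  have : inner ℂ (b i) y = 0 := by
    rw [sub_eq_zero.1 hz, inner_smul_left, hy, mul_zero]
  simp [this]

/-- The polynomial spectral bound behind the power trick: if `0 ≤ K - T` and `E` is the lowest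
eigenvalue of `T`, then `(K - T) ^ n ≤ (K - E) ^ n` as quadratic forms. -/
theorem re_inner_pow_le [FiniteDimensional ℂ V] {T : V →L[ℂ] V}
    (hT : (T : V →ₗ[ℂ] V).IsSymmetric) {E K : ℝ}
    (hE : ∀ (E' : ℝ) (χ : V), χ ≠ 0 → T χ = (E' : ℂ) • χ → E ≤ E' ∧ E' ≤ K)
    {A : V →L[ℂ] V} (hA : ∀ v, A v = (K : ℂ) • v - T v) (n : ℕ) (v : V) :
    (inner ℂ v ((A ^ n) v)).re ≤ (K - E) ^ n * ‖v‖ ^ 2 := by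
  obtain ⟨b, μ, hb⟩ := exists_eigenbasis hT
  have hAs : (A : V →ₗ[ℂ] V).IsSymmetric := fun x y => by
    have := hT x y
    simp only [ContinuousLinearMap.coe_coe] at this ⊢
    rw [hA, hA, inner_sub_left, inner_sub_right, this, inner_smul_left, inner_smul_right,
      Complex.conj_ofReal]
  have hAn : ((A ^ n : V →L[ℂ] V) : V →ₗ[ℂ] V).IsSymmetric := by
    rw [ContinuousLinearMap.toLinearMap_pow]
    exact hAs.pow n
  have hAb : ∀ i, (A ^ n) (b i) = (((K - μ i) ^ n : ℝ) : ℂ) • b i := by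
    intro i
    induction n with
    | zero => simp
    | succ n ih =>
      have ih := ih (by rw [ContinuousLinearMap.toLinearMap_pow]; exact hAs.pow n)
      rw [pow_succ, mul_apply_eq_comp, hA, hb, ← sub_smul, map_smul, ih, smul_smul]
      congr 1
      push_cast
      ring
  rw [re_inner_eq_sum_eigenbasis hAn b hAb, ← b.sum_sq_norm_inner_right v, Finset.mul_sum]
  refine Finset.sum_le_sum fun i _ => ?_
  have := hE _ _ (b.orthonormal.ne_zero i) (hb i)
  have h1 : 0 ≤ K - μ i := by linarith [this.2]
  gcongr
  exact this.1

end Spectral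

/-! ### The gap of a matrix with large positive entries -/

section PositiveMatrix

variable {ι : Type*} [Fintype ι]

/-- The vector of moduli of the amplitudes of `w`. -/
noncomputable def modulus (w : EuclideanSpace ℂ ι) : EuclideanSpace ℂ ι :=
  WithLp.toLp 2 fun i => ((‖w i‖ : ℝ) : ℂ)

theorem norm_modulus (w : EuclideanSpace ℂ ι) : ‖modulus w‖ = ‖w‖ := by
  simp [EuclideanSpace.norm_eq, modulus]

variable [DecidableEq ι]

theorem inner_toEuclideanCLM_ofReal (B : Matrix ι ι ℝ) (v w : EuclideanSpace ℂ ι) :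
    inner ℂ v (Matrix.toEuclideanCLM (n := ι) (𝕜 := ℂ) (B.map Complex.ofReal) w) =
      ∑ i, ∑ j, (B i j : ℂ) * (star (v i) * w j) := by
  rw [PiLp.inner_apply]
  refine Finset.sum_congr rfl fun i _ => ?_
  have : (Matrix.toEuclideanCLM (n := ι) (𝕜 := ℂ) (B.map Complex.ofReal) w) i
      = ∑ j, (B i j : ℂ) * w j := by
    rw [Matrix.ofLp_toEuclideanCLM]; rfl
  rw [this, RCLike.inner_apply, Finset.sum_mul]
  refine Finset.sum_congr rfl fun j _ => ?_
  simp
  ring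

theorem inner_modulus (B : Matrix ι ι ℝ) (w : EuclideanSpace ℂ ι) :
    (inner ℂ (modulus w) (Matrix.toEuclideanCLM (n := ι) (𝕜 := ℂ) (B.map Complex.ofReal)
      (modulus w))).re = ∑ i, ∑ j, B i j * (‖w i‖ * ‖w j‖) := by
  rw [inner_toEuclideanCLM_ofReal]
  simp only [modulus, RCLike.star_def, Complex.conj_ofReal, Complex.re_sum]
  refine Finset.sum_congr rfl fun i _ => Finset.sum_congr rfl fun j _ => ?_
  rw [← Complex.ofReal_mul, ← Complex.ofReal_mul, Complex.ofReal_re]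

/-- Passing to moduli increases the quadratic form of a matrix with entries at least `m`, by at
least `m ‖w‖²` if the amplitudes of `w` sum to zero: on such vectors `m` may be subtracted from
every entry. -/
theorem re_inner_add_le_modulus {B : Matrix ι ι ℝ} {m : ℝ} (hm : 0 ≤ m) (hB : ∀ i j, m ≤ B i j)
    (w : EuclideanSpace ℂ ι) (hw : ∑ i, w i = 0) :
    (inner ℂ w (Matrix.toEuclideanCLM (n := ι) (𝕜 := ℂ) (B.map Complex.ofReal) w)).re
      + m * ‖w‖ ^ 2 ≤ (inner ℂ (modulus w)
        (Matrix.toEuclideanCLM (n := ι) (𝕜 := ℂ) (B.map Complex.ofReal) (modulus w))).re := by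
  rw [inner_modulus, inner_toEuclideanCLM_ofReal]
  have h0 : ∑ i, ∑ j, (m : ℂ) * (star (w i) * w j) = 0 := by
    simp_rw [← Finset.mul_sum, hw]
    simp
  have h1 : (∑ i, ∑ j, (B i j : ℂ) * (star (w i) * w j)).re
      = ∑ i, ∑ j, (B i j - m) * (star (w i) * w j).re := by
    rw [← sub_zero (∑ i, ∑ j, (B i j : ℂ) * (star (w i) * w j)), ← h0, ← Finset.sum_sub_distrib,
      Complex.re_sum]
    refine Finset.sum_congr rfl fun i _ => ?_
    rw [← Finset.sum_sub_distrib, Complex.re_sum]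
    refine Finset.sum_congr rfl fun j _ => ?_
    rw [← sub_mul, ← Complex.ofReal_sub, Complex.re_ofReal_mul]
  have h2 : ‖w‖ ^ 2 ≤ ∑ i, ∑ j, ‖w i‖ * ‖w j‖ := by
    rw [EuclideanSpace.norm_sq_eq]
    refine Finset.sum_le_sum fun i _ => ?_
    rw [sq]
    exact Finset.single_le_sum (f := fun j => ‖w i‖ * ‖w j‖) (fun j _ => by positivity)
      (Finset.mem_univ i)
  have h3 : ∑ i, ∑ j, (B i j - m) * (star (w i) * w j).re
      ≤ ∑ i, ∑ j, (B i j - m) * (‖w i‖ * ‖w j‖) := by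
    refine Finset.sum_le_sum fun i _ => Finset.sum_le_sum fun j _ => ?_
    refine mul_le_mul_of_nonneg_left ?_ (sub_nonneg.2 (hB i j))
    refine (Complex.re_le_norm _).trans ?_
    simp
  have h4 : ∑ i, ∑ j, (B i j - m) * (‖w i‖ * ‖w j‖)
      = ∑ i, ∑ j, B i j * (‖w i‖ * ‖w j‖) - m * ∑ i, ∑ j, ‖w i‖ * ‖w j‖ := by
    simp_rw [sub_mul, Finset.sum_sub_distrib, Finset.mul_sum]
  rw [h1]
  nlinarith

/-- A symmetric matrix whose entries are at least `m` has a gap of at least `m` below its largest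
eigenvalue: a suitable combination of the two eigenvectors has amplitudes summing to zero. -/
theorem add_le_of_entries_ge {B : Matrix ι ι ℝ} {m : ℝ} (hm : 0 ≤ m) (hB : ∀ i j, m ≤ B i j)
    {T : EuclideanSpace ℂ ι →L[ℂ] EuclideanSpace ℂ ι}
    (hTB : T = Matrix.toEuclideanCLM (n := ι) (𝕜 := ℂ) (B.map Complex.ofReal))
    {μ₀ μ₁ : ℝ} {φ χ : EuclideanSpace ℂ ι} (hφ : T φ = (μ₀ : ℂ) • φ) (hφ1 : ‖φ‖ = 1)
    (hχ : T χ = (μ₁ : ℂ) • χ) (hχ0 : χ ≠ 0) (horth : inner ℂ φ χ = 0)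
    (hmax : ∀ v, (inner ℂ v (T v)).re ≤ μ₀ * ‖v‖ ^ 2) : μ₁ + m ≤ μ₀ := by
  have key : ∀ w : EuclideanSpace ℂ ι, w ≠ 0 → ∑ i, w i = 0 →
      μ₁ * ‖w‖ ^ 2 ≤ (inner ℂ w (T w)).re → μ₁ + m ≤ μ₀ := by
    intro w hw0 hw hlow
    have h1 := re_inner_add_le_modulus hm hB w hw
    rw [← hTB] at h1
    have h2 := hmax (modulus w)
    rw [norm_modulus] at h2
    have h3 : 0 < ‖w‖ ^ 2 := by positivity
    by_contra hlt
    nlinarith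
  have hχχ : ∀ (c : ℂ), inner ℂ χ (c • χ) = c * ((‖χ‖ ^ 2 : ℝ) : ℂ) := by
    intro c
    rw [inner_smul_right, inner_self_eq_norm_sq_to_K]; simp
  have horth' : inner ℂ χ φ = 0 := by rw [← inner_conj_symm, horth, map_zero]
  have hle : μ₁ * ‖χ‖ ^ 2 ≤ μ₀ * ‖χ‖ ^ 2 := by
    have := hmax χ
    rwa [hχ, hχχ, ← Complex.ofReal_mul, Complex.ofReal_re] at this
  by_cases hs : ∑ i, χ i = 0
  · refine key χ hχ0 hs ?_
    rw [hχ, hχχ, ← Complex.ofReal_mul, Complex.ofReal_re]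
  set β : ℂ := -(∑ i, φ i) / ∑ i, χ i with hβ
  have hφφ : inner ℂ φ φ = (1 : ℂ) := inner_self_of_norm_eq_one hφ1
  have hχχ' : inner ℂ χ χ = ((‖χ‖ ^ 2 : ℝ) : ℂ) := by
    simp [inner_self_eq_norm_sq_to_K]
  have hnorm : ‖φ + β • χ‖ ^ 2 = 1 + ‖β‖ ^ 2 * ‖χ‖ ^ 2 := by
    have h := norm_add_sq_eq_norm_sq_add_norm_sq_of_inner_eq_zero (𝕜 := ℂ) φ (β • χ)
      (by rw [inner_smul_right, horth, mul_zero])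
    rw [norm_smul, hφ1] at h
    nlinarith
  refine key (φ + β • χ) ?_ ?_ ?_
  · intro h0
    rw [h0] at hnorm
    have : 0 ≤ ‖β‖ ^ 2 * ‖χ‖ ^ 2 := by positivity
    simp only [norm_zero] at hnorm
    linarith
  · simp only [PiLp.add_apply, PiLp.smul_apply, smul_eq_mul, Finset.sum_add_distrib,
      ← Finset.mul_sum]
    rw [hβ]
    field_simp
    ring
  · have : inner ℂ (φ + β • χ) (T (φ + β • χ))
        = ((μ₀ + μ₁ * (‖β‖ ^ 2 * ‖χ‖ ^ 2) : ℝ) : ℂ) := by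
      have hb : (starRingEnd ℂ) β * β = ((‖β‖ ^ 2 : ℝ) : ℂ) := by
        rw [mul_comm, Complex.mul_conj, Complex.normSq_eq_norm_sq]
      simp only [map_add, map_smul, hφ, hχ, inner_add_left, inner_add_right, inner_smul_left,
        inner_smul_right, hφφ, hχχ', horth, horth']
      push_cast at hb ⊢
      linear_combination (μ₁ : ℂ) * (‖χ‖ : ℂ) ^ 2 * hb
    rw [this, hnorm, Complex.ofReal_re]
    have hle' : μ₁ ≤ μ₀ := le_of_mul_le_mul_right hle (by positivity)
    nlinarith

end PositiveMatrix

/-! ### The Hamiltonian in the computational basis -/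

section Spins

variable {N : ℕ}

/-- The configuration `s` with the spin at site `i` flipped. -/
def flipAt (i : Fin N) (s : Config N) : Config N := Function.update s i (1 - s i)

theorem flipAt_flipAt (i : Fin N) (s : Config N) : flipAt i (flipAt i s) = s := by
  ext j
  by_cases h : j = i
  · subst h; simp [flipAt]
  · simp [flipAt, h]

theorem sigmaX_apply (i : Fin N) (s s' : Config N) :
    sigmaX i s s' = if s' = flipAt i s then 1 else 0 := by
  have hX : ∀ a b : Fin 2, pauliX a b = if b = 1 - a then 1 else 0 := by
    intro a b; fin_cases a <;> fin_cases b <;> simp [pauliX]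
  simp only [sigmaX, tensorOp, Matrix.of_apply]
  split_ifs with h
  · subst h
    refine Finset.prod_eq_one fun j _ => ?_
    by_cases hj : j = i
    · subst hj; simp [hX, flipAt]
    · rw [if_neg hj, flipAt, Function.update_of_ne hj, Matrix.one_apply_eq]
  · obtain ⟨j, hj⟩ := Function.ne_iff.1 h
    refine Finset.prod_eq_zero (Finset.mem_univ j) ?_
    by_cases hji : j = i
    · subst hji
      simp only [flipAt, Function.update_self] at hj
      simp [hX, hj]
    · simp only [flipAt, Function.update_of_ne hji] at hj
      simp [hji, hj.symm]

theorem op_sigmaX_apply (i : Fin N) (v : SpinSpace N) (s : Config N) :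
    op (sigmaX i) v s = v (flipAt i s) := by
  have : op (sigmaX i) v s = ∑ s', sigmaX i s s' * v s' := by
    rw [op, Matrix.ofLp_toEuclideanCLM]; rfl
  simp [this, sigmaX_apply]

theorem norm_op_sigmaX_apply (i : Fin N) (v : SpinSpace N) : ‖op (sigmaX i) v‖ = ‖v‖ := by
  rw [EuclideanSpace.norm_eq, EuclideanSpace.norm_eq]
  congr 1
  simp_rw [op_sigmaX_apply]
  exact Equiv.sum_comp (Function.Involutive.toPerm (flipAt i) (flipAt_flipAt i))
    (fun s => ‖v s‖ ^ 2)

/-- The total transverse field operator `∑ i, σ^x_i`. -/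
noncomputable def transverse (N : ℕ) : SpinSpace N →L[ℂ] SpinSpace N := ∑ i, op (sigmaX i)

theorem norm_transverse_le : ‖transverse N‖ ≤ N := by
  refine (norm_sum_le _ _).trans ?_
  refine (Finset.sum_le_card_nsmul _ _ 1 fun i _ => ?_).trans (by simp)
  exact ContinuousLinearMap.opNorm_le_bound _ zero_le_one fun v => by
    rw [norm_op_sigmaX_apply, one_mul]

theorem transverse_apply (v : SpinSpace N) (s : Config N) :
    transverse N v s = ∑ i, v (flipAt i s) := by
  simp [transverse, op_sigmaX_apply]

theorem pauliZ_diag (a b : Fin 2) :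
    pauliZ a b = if a = b then (((-1) ^ (a : ℕ) : ℝ) : ℂ) else 0 := by
  fin_cases a <;> fin_cases b <;> simp [pauliZ]

/-- The classical energy of a configuration: the diagonal entry of the Ising Hamiltonian. -/
noncomputable def isingEnergy (J : Finset (Fin N) → ℝ) (s : Config N) : ℝ :=
  -∑ S : Finset (Fin N), J S * ∏ j, if j ∈ S then (-1) ^ (s j : ℕ) else 1

theorem sigmaZ_eq (S : Finset (Fin N)) :
    sigmaZ S = Matrix.diagonal fun s : Config N =>
      ((∏ j, if j ∈ S then (-1) ^ (s j : ℕ) else 1 : ℝ) : ℂ) := by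
  ext s s'
  simp only [sigmaZ, tensorOp, Matrix.of_apply]
  by_cases h : s = s'
  · subst h
    rw [Matrix.diagonal_apply_eq, Complex.ofReal_prod]
    refine Finset.prod_congr rfl fun j _ => ?_
    by_cases hj : j ∈ S <;> simp [hj, pauliZ_diag]
  · rw [Matrix.diagonal_apply_ne _ h]
    obtain ⟨j, hj⟩ := Function.ne_iff.1 h
    refine Finset.prod_eq_zero (Finset.mem_univ j) ?_
    by_cases hjS : j ∈ S <;> simp [hjS, pauliZ_diag, hj]

theorem isingHamiltonian_apply (J : Finset (Fin N) → ℝ) (v : SpinSpace N) (s : Config N) :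
    isingHamiltonian J v s = (isingEnergy J s : ℂ) * v s := by
  have h : ∀ S : Finset (Fin N), op (sigmaZ S) v s
      = ((∏ j, if j ∈ S then (-1) ^ (s j : ℕ) else 1 : ℝ) : ℂ) * v s := by
    intro S
    rw [op, Matrix.ofLp_toEuclideanCLM, sigmaZ_eq, Matrix.mulVec_diagonal]
  simp only [isingHamiltonian, isingEnergy, neg_apply, sum_apply, smul_apply, PiLp.neg_apply,
    WithLp.ofLp_sum, Finset.sum_apply, PiLp.smul_apply, smul_eq_mul, h]
  rw [Complex.ofReal_neg, Complex.ofReal_sum, neg_mul, Finset.sum_mul]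
  simp_rw [Complex.ofReal_mul, mul_assoc]

theorem abs_isingEnergy_le (J : Finset (Fin N) → ℝ) (s : Config N) :
    |isingEnergy J s| ≤ ‖isingHamiltonian J‖ := by
  have h := (isingHamiltonian J).le_opNorm (EuclideanSpace.single s 1)
  have h1 : isingHamiltonian J (EuclideanSpace.single s 1)
      = EuclideanSpace.single s (isingEnergy J s : ℂ) := by
    ext s'
    rw [isingHamiltonian_apply]
    by_cases hs : s' = s
    · subst hs; simp
    · simp [hs]
  rw [h1] at h
  simpa using h

theorem hamiltonian_eq (J : Finset (Fin N) → ℝ) (γ : ℝ) :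
    hamiltonian J γ = isingHamiltonian J - (γ : ℂ) • transverse N := rfl

/-- The real matrix of `K - H(γ)` in the computational basis. -/
noncomputable def shiftedMatrix (J : Finset (Fin N) → ℝ) (γ K : ℝ) :
    Matrix (Config N) (Config N) ℝ :=
  Matrix.of fun s s' => (if s' = s then K - isingEnergy J s else 0) +
    γ * ∑ i, if s' = flipAt i s then 1 else 0

theorem sum_shiftedMatrix_mul (J : Finset (Fin N) → ℝ) (γ K : ℝ) (s : Config N)
    (f : Config N → ℝ) : ∑ s', shiftedMatrix J γ K s s' * f s'
      = (K - isingEnergy J s) * f s + γ * ∑ i, f (flipAt i s) := by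
  simp only [shiftedMatrix, Matrix.of_apply, add_mul, Finset.sum_add_distrib, ite_mul, zero_mul,
    Finset.sum_ite_eq', Finset.mem_univ, if_true, mul_assoc, Finset.sum_mul,
    ← Finset.mul_sum]
  congr 2
  rw [Finset.sum_comm]
  simp

theorem op_shiftedMatrix_apply (J : Finset (Fin N) → ℝ) (γ K : ℝ) (v : SpinSpace N) :
    op ((shiftedMatrix J γ K).map Complex.ofReal) v = (K : ℂ) • v - hamiltonian J γ v := by
  ext s
  have h1 : op ((shiftedMatrix J γ K).map Complex.ofReal) v s
      = ∑ s', (shiftedMatrix J γ K s s' : ℂ) * v s' := by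
    rw [op, Matrix.ofLp_toEuclideanCLM]; rfl
  rw [h1, hamiltonian_eq]
  simp only [sub_apply, smul_apply, PiLp.sub_apply,
    PiLp.smul_apply, isingHamiltonian_apply, transverse_apply, smul_eq_mul]
  simp only [shiftedMatrix, Matrix.of_apply, Complex.ofReal_add, Complex.ofReal_mul,
    Complex.ofReal_sum, apply_ite Complex.ofReal, Complex.ofReal_zero, Complex.ofReal_one,
    add_mul, Finset.sum_add_distrib, ite_mul, zero_mul, Finset.sum_ite_eq', Finset.mem_univ,
    if_true, mul_assoc, Finset.sum_mul, ← Finset.mul_sum]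
  rw [Finset.sum_comm]
  simp
  ring

theorem shiftedMatrix_symm (J : Finset (Fin N) → ℝ) (γ K : ℝ) (s s' : Config N) :
    shiftedMatrix J γ K s s' = shiftedMatrix J γ K s' s := by
  have hflip : ∀ i, s' = flipAt i s ↔ s = flipAt i s' := fun i => by
    constructor <;> · rintro rfl; rw [flipAt_flipAt]
  simp only [shiftedMatrix, Matrix.of_apply, hflip]
  by_cases h : s = s'
  · subst h; rfl
  · rw [if_neg h, if_neg (Ne.symm h)]

theorem hamiltonian_isSymmetric (J : Finset (Fin N) → ℝ) (γ : ℝ) :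
    (hamiltonian J γ : SpinSpace N →ₗ[ℂ] SpinSpace N).IsSymmetric := by
  intro v w
  have key : ∀ v w : SpinSpace N, inner ℂ v (hamiltonian J γ w)
      = -∑ s, ∑ s', (shiftedMatrix J γ 0 s s' : ℂ) * (star (v s) * w s') := by
    intro v w
    have h := op_shiftedMatrix_apply J γ 0 w
    rw [Complex.ofReal_zero, zero_smul, zero_sub] at h
    rw [← neg_neg (hamiltonian J γ w), ← h, inner_neg_right, op, inner_toEuclideanCLM_ofReal]
  simp only [ContinuousLinearMap.coe_coe]
  rw [← inner_conj_symm, key, key, map_neg, map_sum, Finset.sum_comm]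
  congr 1
  refine Finset.sum_congr rfl fun s _ => ?_
  rw [map_sum]
  refine Finset.sum_congr rfl fun s' _ => ?_
  rw [shiftedMatrix_symm J γ 0 s s']
  simp only [map_mul, Complex.conj_ofReal, RCLike.star_def, Complex.conj_conj]
  ring

/-- The powers of `K - H` connect configurations at Hamming distance at most `k`: among the paths
from `s` to `s'` are those flipping the differing spins in any order. -/
theorem le_shiftedMatrix_pow {J : Finset (Fin N) → ℝ} {γ K : ℝ} (hγ : 0 ≤ γ)
    (hK : ∀ s, N * γ ≤ K - isingEnergy J s) (k : ℕ) (hk : k ≤ N) :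
    ∀ s s', 0 ≤ (shiftedMatrix J γ K ^ k) s s' ∧
      (hammingDist s s' ≤ k → k.factorial * γ ^ k ≤ (shiftedMatrix J γ K ^ k) s s') := by
  induction k with
  | zero =>
    intro s s'
    refine ⟨by rw [pow_zero, Matrix.one_apply]; split_ifs <;> simp, fun h => ?_⟩
    have : s = s' := by simpa using h
    subst this
    simp
  | succ k ih =>
    have ih := ih (by omega)
    intro s s'
    have hrec : (shiftedMatrix J γ K ^ (k + 1)) s s'
        = (K - isingEnergy J s) * (shiftedMatrix J γ K ^ k) s s'
          + γ * ∑ i, (shiftedMatrix J γ K ^ k) (flipAt i s) s' := by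
      rw [pow_succ', Matrix.mul_apply]
      exact sum_shiftedMatrix_mul J γ K s fun u => (shiftedMatrix J γ K ^ k) u s'
    have hsum : 0 ≤ γ * ∑ i, (shiftedMatrix J γ K ^ k) (flipAt i s) s' :=
      mul_nonneg hγ (Finset.sum_nonneg fun i _ => (ih _ _).1)
    have hNγ : 0 ≤ (N : ℝ) * γ := by positivity
    have hdiag : 0 ≤ (K - isingEnergy J s) * (shiftedMatrix J γ K ^ k) s s' :=
      mul_nonneg (hNγ.trans (hK s)) (ih _ _).1
    rw [hrec]
    refine ⟨by positivity, fun hd => ?_⟩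
    have hfac : ((k + 1).factorial : ℝ) * γ ^ (k + 1)
        = ((k + 1 : ℕ) * γ) * (k.factorial * γ ^ k) := by
      rw [Nat.factorial_succ]; push_cast; ring
    have hpos : 0 ≤ (k.factorial : ℝ) * γ ^ k := by positivity
    rw [hfac]
    by_cases hle : hammingDist s s' ≤ k
    · have h1 : ((k + 1 : ℕ) : ℝ) * γ ≤ K - isingEnergy J s := by
        refine le_trans ?_ (hK s)
        gcongr
      have := mul_le_mul h1 ((ih s s').2 hle) hpos (hNγ.trans (hK s))
      linarith
    · have hd' : hammingDist s s' = k + 1 := by omega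
      -- each differing site is a first step towards `s'`
      have hflip : ∀ i ∈ Finset.univ.filter fun i => s i ≠ s' i,
          k.factorial * γ ^ k ≤ (shiftedMatrix J γ K ^ k) (flipAt i s) s' := by
        intro i hi
        refine (ih _ _).2 ?_
        have hi' : s i ≠ s' i := (Finset.mem_filter.1 hi).2
        have hlt : hammingDist (flipAt i s) s' < hammingDist s s' := by
          refine Finset.card_lt_card ?_
          rw [Finset.ssubset_iff_of_subset]
          · refine ⟨i, hi, ?_⟩
            have h2 : ∀ a b : Fin 2, a ≠ b → 1 - a = b := by decide
            simp [flipAt, h2 _ _ hi']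
          · intro j hj
            by_cases hji : j = i
            · subst hji; simpa using hi'
            · have hj' := (Finset.mem_filter.1 hj).2
              rw [flipAt, Function.update_of_ne hji] at hj'
              exact Finset.mem_filter.2 ⟨Finset.mem_univ _, hj'⟩
        omega
      have h3 : ((k + 1 : ℕ) : ℝ) * (k.factorial * γ ^ k)
          ≤ ∑ i, (shiftedMatrix J γ K ^ k) (flipAt i s) s' := by
        rw [← hd', hammingDist, ← nsmul_eq_mul]
        refine (Finset.card_nsmul_le_sum _ _ _ hflip).trans ?_
        exact Finset.sum_le_sum_of_subset_of_nonneg (Finset.subset_univ _)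
          fun i _ _ => (ih _ _).1
      nlinarith [mul_le_mul_of_nonneg_left h3 hγ]

end Spins

/-! ### The spectral gap of the transverse-field Ising Hamiltonian -/

section Gap

variable {N : ℕ}

theorem pow_sub_pow_le_mul {x y : ℝ} (hy : 0 ≤ y) (hyx : y ≤ x) (n : ℕ) :
    x ^ (n + 1) - y ^ (n + 1) ≤ (n + 1) * x ^ n * (x - y) := by
  induction n with
  | zero => simp
  | succ n ih =>
    have hx : 0 ≤ x := hy.trans hyx
    have h1 : y ^ (n + 1) ≤ x ^ (n + 1) := by gcongr
    have h2 := mul_le_mul_of_nonneg_left ih hx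
    have h3 := mul_le_mul_of_nonneg_right h1 (sub_nonneg.2 hyx)
    push_cast
    calc x ^ (n + 1 + 1) - y ^ (n + 1 + 1)
        = x * (x ^ (n + 1) - y ^ (n + 1)) + y ^ (n + 1) * (x - y) := by ring
      _ ≤ x * ((n + 1) * x ^ n * (x - y)) + x ^ (n + 1) * (x - y) := add_le_add h2 h3
      _ = _ := by ring

/-- The explicit lower bound `√N e^{-bN} γ ^ N` for the gap at transverse field `γ`. -/
noncomputable def gapBound (N : ℕ) (b γ : ℝ) : ℝ := √(N : ℝ) * Real.exp (-(b * N)) * γ ^ N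

theorem gapBound_pos (hN : 1 ≤ N) (b : ℝ) {γ : ℝ} (hγ : 0 < γ) : 0 < gapBound N b γ := by
  have : (0 : ℝ) < N := by exact_mod_cast hN
  unfold gapBound
  positivity

/-- The rate of exponential decay of the gap, for energy per spin at most `C` and transverse
field at most `M`. -/
noncomputable def gapRate (C M : ℝ) : ℝ := 2 + Real.log (2 * (C + M))

theorem gapRate_pos {C M : ℝ} (hC : 0 < C) (hM : 1 ≤ M) : 0 < gapRate C M := by
  have : 0 ≤ Real.log (2 * (C + M)) := Real.log_nonneg (by linarith)
  unfold gapRate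
  linarith

theorem gapBound_mul_le (hN : 1 ≤ N) {C M γ : ℝ} (hC : 0 < C) (hM : 1 ≤ M) (hγ : 0 < γ) :
    gapBound N (gapRate C M) γ * (N * (2 * (C + M) * N) ^ (N - 1)) ≤ N.factorial * γ ^ N := by
  set Q := 2 * (C + M) with hQ
  have hQ1 : 1 ≤ Q := by rw [hQ]; linarith
  have hN0 : (0 : ℝ) < N := by exact_mod_cast hN
  have hsqrt : √(N : ℝ) ≤ Real.exp N := by
    have h1 : √(N : ℝ) ≤ N := by
      rw [Real.sqrt_le_left hN0.le]
      have : (1 : ℝ) ≤ N := by exact_mod_cast hN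
      nlinarith
    linarith [Real.add_one_le_exp (N : ℝ)]
  have hexp : Real.exp (-(gapRate C M * N)) = Real.exp (-N) * Real.exp (-N) * (Q ^ N)⁻¹ := by
    rw [gapRate, ← hQ, show -((2 + Real.log Q) * N) = -(N : ℝ) + -N + -(N * Real.log Q) by ring,
      Real.exp_add, Real.exp_add, Real.exp_neg (N * Real.log Q), Real.exp_nat_mul,
      Real.exp_log (by linarith)]
  have hfac : (N : ℝ) ^ N ≤ N.factorial * Real.exp N := by
    have := Real.pow_div_factorial_le_exp (N : ℝ) hN0.le N
    rwa [div_le_iff₀ (by positivity), mul_comm] at this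
  have hpow : (N : ℝ) * (Q * N) ^ (N - 1) ≤ N ^ N * Q ^ N := by
    rw [mul_pow, mul_left_comm, mul_comm]
    have h1 : (N : ℝ) * N ^ (N - 1) = N ^ N := by
      rw [← pow_succ', Nat.sub_add_cancel hN]
    rw [h1]
    gcongr
    exact Nat.sub_le N 1
  have hQN : 0 < Q ^ N := by positivity
  calc gapBound N (gapRate C M) γ * (N * (Q * N) ^ (N - 1))
      ≤ (Real.exp N * (Real.exp (-N) * Real.exp (-N) * (Q ^ N)⁻¹) * γ ^ N) *
        ((N.factorial * Real.exp N) * Q ^ N) := by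
        rw [gapBound, hexp]
        refine mul_le_mul ?_ (hpow.trans (mul_le_mul_of_nonneg_right hfac hQN.le))
          (by positivity) (by positivity)
        gcongr
    _ = N.factorial * γ ^ N * (Real.exp N * Real.exp (-N)) * (Real.exp N * Real.exp (-N))
        * ((Q ^ N)⁻¹ * Q ^ N) := by ring
    _ = N.factorial * γ ^ N := by
        rw [← Real.exp_add, add_neg_cancel, Real.exp_zero, inv_mul_cancel₀ hQN.ne']
        ring

variable {J : Finset (Fin N) → ℝ} {C M γ : ℝ}

theorem norm_hamiltonian_le (hJ : ‖isingHamiltonian J‖ ≤ C * N) (hγ : 0 ≤ γ) (hγM : γ ≤ M) :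
    ‖hamiltonian J γ‖ ≤ (C + M) * N := by
  rw [hamiltonian_eq]
  refine (norm_sub_le _ _).trans ?_
  rw [norm_smul, Complex.norm_real, Real.norm_of_nonneg hγ]
  have := mul_le_mul hγM (norm_transverse_le (N := N)) (norm_nonneg _) (hγ.trans hγM)
  linarith

theorem abs_eigenvalue_le {V : Type*} [NormedAddCommGroup V] [InnerProductSpace ℂ V]
    {T : V →L[ℂ] V} {E : ℝ} {χ : V} (hχ : χ ≠ 0)
    (h : T χ = (E : ℂ) • χ) : |E| ≤ ‖T‖ := by
  have := T.le_opNorm χ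
  rw [h, norm_smul, Complex.norm_real, Real.norm_eq_abs] at this
  exact le_of_mul_le_mul_right this (by positivity)

/-- The gap bound: apply `add_le_of_entries_ge` to `(K - H) ^ N` with `K = (C + M) N`, whose
entries are at least `N! γ ^ N`, and take `N`-th roots. -/
theorem add_gapBound_le (hN : 1 ≤ N) (hC : 0 < C) (hM : 1 ≤ M)
    (hJ : ‖isingHamiltonian J‖ ≤ C * N) (hγ : 0 < γ) (hγM : γ ≤ M) {E E' : ℝ} {φ χ : SpinSpace N}
    (hφ : IsGroundState (hamiltonian J γ) E φ) (hχ0 : χ ≠ 0) (horth : inner ℂ φ χ = 0)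
    (hχ : hamiltonian J γ χ = (E' : ℂ) • χ) : E + gapBound N (gapRate C M) γ ≤ E' := by
  obtain ⟨hφ1, hφE, hmin⟩ := hφ
  set K : ℝ := (C + M) * N with hK
  have hN0 : (0 : ℝ) < N := by exact_mod_cast hN
  have hφ0 : φ ≠ 0 := by rintro rfl; simp at hφ1
  have hnorm := norm_hamiltonian_le hJ hγ.le hγM
  have hspec : ∀ (E' : ℝ) (χ : SpinSpace N), χ ≠ 0 → hamiltonian J γ χ = (E' : ℂ) • χ →
      |E'| ≤ K := fun E' χ h0 h => (abs_eigenvalue_le h0 h).trans hnorm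
  set A : SpinSpace N →L[ℂ] SpinSpace N := op ((shiftedMatrix J γ K).map Complex.ofReal) with hA
  have hAv : ∀ v, A v = (K : ℂ) • v - hamiltonian J γ v := op_shiftedMatrix_apply J γ K
  have hApow : A ^ N = Matrix.toEuclideanCLM (n := Config N) (𝕜 := ℂ)
      ((shiftedMatrix J γ K ^ N).map Complex.ofReal) := by
    rw [hA, op, ← map_pow]
    congr 1
    exact (Matrix.map_pow (shiftedMatrix J γ K) Complex.ofRealHom N).symm
  have hAeig : ∀ (E' : ℝ) (χ : SpinSpace N), hamiltonian J γ χ = (E' : ℂ) • χ →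
      (A ^ N) χ = (((K - E') ^ N : ℝ) : ℂ) • χ := by
    intro E' χ h
    have h1 : A χ = ((K - E' : ℝ) : ℂ) • χ := by
      rw [hAv, h, ← sub_smul, Complex.ofReal_sub]
    have h2 : ∀ n : ℕ, (A ^ n) χ = (((K - E') ^ n : ℝ) : ℂ) • χ := by
      intro n
      induction n with
      | zero => simp
      | succ n ih =>
        rw [pow_succ, mul_apply_eq_comp, h1, map_smul, ih, smul_smul, pow_succ,
          Complex.ofReal_mul, mul_comm]
    exact h2 N
  have hdiag : ∀ s, N * γ ≤ K - isingEnergy J s := fun s => by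
    have h1 := (le_abs_self _).trans ((abs_isingEnergy_le J s).trans hJ)
    have h2 : N * γ ≤ N * M := by gcongr
    rw [hK]; linarith
  have hent : ∀ s s', N.factorial * γ ^ N ≤ (shiftedMatrix J γ K ^ N) s s' := fun s s' =>
    (le_shiftedMatrix_pow hγ.le hdiag N le_rfl s s').2
      (hammingDist_le_card_fintype.trans (by simp))
  have hE := abs_le.1 (hspec E φ hφ0 hφE)
  have hE' := abs_le.1 (hspec E' χ hχ0 hχ)
  have hEE' := hmin E' χ hχ0 hχ
  have hgap := add_le_of_entries_ge (by positivity) hent hApow (hAeig E φ hφE) hφ1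
    (hAeig E' χ hχ) hχ0 horth
    (re_inner_pow_le (hamiltonian_isSymmetric J γ)
      (fun E' χ h0 h => ⟨hmin E' χ h0 h, (abs_le.1 (hspec E' χ h0 h)).2⟩) hAv N)
  have hbern := pow_sub_pow_le_mul (sub_nonneg.2 hE'.2) (sub_le_sub_left hEE' K) (N - 1)
  rw [Nat.sub_add_cancel hN, Nat.cast_sub hN, Nat.cast_one, sub_add_cancel] at hbern
  have hX : (K - E) ^ (N - 1) ≤ (2 * (C + M) * N) ^ (N - 1) := by
    gcongr
    · linarith [hE.2]
    · rw [hK] at hE ⊢; linarith [hE.1]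
  have hX' : N * (K - E) ^ (N - 1) * (K - E - (K - E'))
      ≤ N * (2 * (C + M) * N) ^ (N - 1) * (E' - E) := by
    rw [show K - E - (K - E') = E' - E by ring]
    have := sub_nonneg.2 hEE'
    gcongr
  have hfin := gapBound_mul_le hN hC hM hγ
  have hpos : 0 < N * (2 * (C + M) * N) ^ (N - 1) := by positivity
  have : gapBound N (gapRate C M) γ * (N * (2 * (C + M) * N) ^ (N - 1))
      ≤ (E' - E) * (N * (2 * (C + M) * N) ^ (N - 1)) := by linarith
  linarith [le_of_mul_le_mul_right this hpos]

theorem coercive_hamiltonian (hN : 1 ≤ N) (hC : 0 < C) (hM : 1 ≤ M)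
    (hJ : ‖isingHamiltonian J‖ ≤ C * N) (hγ : 0 < γ) (hγM : γ ≤ M) {E : ℝ} {φ : SpinSpace N}
    (hφ : IsGroundState (hamiltonian J γ) E φ) {y : SpinSpace N} (hy : inner ℂ φ y = 0) :
    (E + gapBound N (gapRate C M) γ) * ‖y‖ ^ 2 ≤ (inner ℂ y (hamiltonian J γ y)).re :=
  coercive_of_eigenvector_gap (hamiltonian_isSymmetric J γ) hφ.1 hφ.2.1 (gapBound_pos hN _ hγ)
    (fun _ _ h0 ho h => add_gapBound_le hN hC hM hJ hγ hγM hφ h0 ho h) hy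

/-- A ground state together with an orthogonal eigenvector; the latter exists because the
dimension `2 ^ N` is at least two. -/
theorem exists_isGroundState_and_orthogonal (hN : 1 ≤ N) (J : Finset (Fin N) → ℝ) (γ : ℝ) :
    ∃ (E₀ E₁ : ℝ) (φ χ : SpinSpace N), IsGroundState (hamiltonian J γ) E₀ φ ∧ χ ≠ 0 ∧
      inner ℂ φ χ = 0 ∧ hamiltonian J γ χ = (E₁ : ℂ) • χ := by
  obtain ⟨b, μ, hb⟩ := exists_eigenbasis (hamiltonian_isSymmetric J γ)
  have hcard : 1 < Module.finrank ℂ (SpinSpace N) := by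
    simp only [finrank_euclideanSpace, Fintype.card_fun, Fintype.card_fin]
    exact Nat.one_lt_two_pow (by omega)
  have : Nontrivial (Fin (Module.finrank ℂ (SpinSpace N))) := Fin.nontrivial_iff_two_le.2 hcard
  obtain ⟨i₀, hi₀⟩ := Finite.exists_min μ
  obtain ⟨i₁, hi₁⟩ := exists_ne i₀
  refine ⟨μ i₀, μ i₁, b i₀, b i₁, ⟨b.orthonormal.1 _, hb _, fun E' χ hχ0 hχ => ?_⟩,
    b.orthonormal.ne_zero i₁, b.orthonormal.2 hi₁.symm, hb _⟩
  have h := re_inner_eq_sum_eigenbasis (hamiltonian_isSymmetric J γ) b hb χ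
  rw [hχ, re_inner_ofReal_smul_self] at h
  have h1 : μ i₀ * ‖χ‖ ^ 2 ≤ E' * ‖χ‖ ^ 2 := by
    rw [h, ← b.sum_sq_norm_inner_right χ, Finset.mul_sum]
    exact Finset.sum_le_sum fun i _ => by gcongr; exact hi₀ i
  exact le_of_mul_le_mul_right h1 (by positivity)

theorem gapBound_le_energyGap (hN : 1 ≤ N) (hC : 0 < C) (hM : 1 ≤ M)
    (hJ : ‖isingHamiltonian J‖ ≤ C * N) (hγ : 0 < γ) (hγM : γ ≤ M) :
    gapBound N (gapRate C M) γ ≤ energyGap (hamiltonian J γ) := by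
  refine le_csInf ?_ ?_
  · obtain ⟨E₀, E₁, φ, χ, h1, h2, h3, h4⟩ := exists_isGroundState_and_orthogonal hN J γ
    exact ⟨E₁ - E₀, E₀, E₁, φ, χ, h1, h2, h3, h4, rfl⟩
  · rintro d ⟨E₀, E₁, φ, χ, h1, h2, h3, h4, rfl⟩
    linarith [add_gapBound_le hN hC hM hJ hγ hγM h1 h2 h3 h4]

theorem IsGroundState.exists_eq_smul (hN : 1 ≤ N) (hC : 0 < C) (hM : 1 ≤ M)
    (hJ : ‖isingHamiltonian J‖ ≤ C * N) (hγ : 0 < γ) (hγM : γ ≤ M) {E E' : ℝ}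
    {φ φ' : SpinSpace N} (hφ : IsGroundState (hamiltonian J γ) E φ)
    (hφ' : IsGroundState (hamiltonian J γ) E' φ') : E' = E ∧ ∃ u : ℂ, ‖u‖ = 1 ∧ φ' = u • φ := by
  have hne : ∀ {v : SpinSpace N}, ‖v‖ = 1 → v ≠ 0 := by rintro v hv rfl; simp at hv
  have hEE : E' = E := le_antisymm (hφ'.2.2 _ _ (hne hφ.1) hφ.2.1) (hφ.2.2 _ _ (hne hφ'.1) hφ'.2.1)
  refine ⟨hEE, inner ℂ φ φ', ?_⟩
  have hφφ : inner ℂ φ φ = (1 : ℂ) := inner_self_of_norm_eq_one hφ.1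
  have hz : φ' - inner ℂ φ φ' • φ = 0 := by
    by_contra hz
    have h1 := add_gapBound_le (E' := E) hN hC hM hJ hγ hγM hφ hz
      (by rw [inner_sub_right, inner_smul_right, hφφ]; simp)
      (by rw [map_sub, map_smul, hφ'.2.1, hφ.2.1, hEE, smul_sub, smul_comm])
    linarith [gapBound_pos hN (gapRate C M) hγ]
  have hz' := sub_eq_zero.1 hz
  refine ⟨?_, hz'⟩
  have := congrArg norm hz'
  rw [norm_smul, hφ.1, hφ'.1, mul_one] at this
  exact this.symm

/-- There is a ground state with nonnegative amplitudes: taking moduli does not increase the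
energy, because the off-diagonal matrix elements of the Hamiltonian are nonpositive. -/
theorem exists_isGroundState_nonneg (hN : 1 ≤ N) (hC : 0 < C) (hM : 1 ≤ M)
    (hJ : ‖isingHamiltonian J‖ ≤ C * N) (hγ : 0 < γ) (hγM : γ ≤ M) :
    ∃ (E : ℝ) (φ : SpinSpace N), IsGroundState (hamiltonian J γ) E φ ∧
      ∀ s, φ s = ((‖φ s‖ : ℝ) : ℂ) := by
  obtain ⟨E, -, φ, -, hφ, -⟩ := exists_isGroundState_and_orthogonal hN J γ
  have hφφ : inner ℂ φ φ = (1 : ℂ) := inner_self_of_norm_eq_one hφ.1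
  set K : ℝ := (C + M) * N with hK
  have hentry : ∀ s s', 0 ≤ shiftedMatrix J γ K s s' := by
    intro s s'
    have hd : 0 ≤ K - isingEnergy J s := by
      have h1 := (le_abs_self _).trans ((abs_isingEnergy_le J s).trans hJ)
      have h2 : (0 : ℝ) ≤ M * N := by positivity
      rw [hK]; linarith
    rw [shiftedMatrix, Matrix.of_apply]
    refine add_nonneg (by split_ifs <;> simp [hd]) (mul_nonneg hγ.le ?_)
    exact Finset.sum_nonneg fun i _ => by split_ifs <;> simp
  have hform : ∀ v : SpinSpace N, (inner ℂ v (op ((shiftedMatrix J γ K).map Complex.ofReal) v)).re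
      = K * ‖v‖ ^ 2 - (inner ℂ v (hamiltonian J γ v)).re := by
    intro v
    rw [op_shiftedMatrix_apply, inner_sub_right, Complex.sub_re, re_inner_ofReal_smul_self]
  set p := modulus φ with hp
  have hp1 : ‖p‖ = 1 := by rw [hp, norm_modulus, hφ.1]
  have henergy : (inner ℂ p (hamiltonian J γ p)).re ≤ E := by
    have h1 : (inner ℂ φ (op ((shiftedMatrix J γ K).map Complex.ofReal) φ)).re
        ≤ (inner ℂ p (op ((shiftedMatrix J γ K).map Complex.ofReal) p)).re := by
      rw [hp, op, inner_modulus, inner_toEuclideanCLM_ofReal]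
      simp only [Complex.re_sum]
      refine Finset.sum_le_sum fun s _ => Finset.sum_le_sum fun s' _ => ?_
      rw [Complex.re_ofReal_mul]
      refine mul_le_mul_of_nonneg_left ?_ (hentry s s')
      refine (Complex.re_le_norm _).trans ?_
      simp
    rw [hform, hform, hp1, hφ.1, hφ.2.1, inner_smul_right, hφφ, mul_one, Complex.ofReal_re] at h1
    linarith
  set β : ℂ := inner ℂ φ p with hβ
  have hy : inner ℂ φ (p - β • φ) = 0 := by
    rw [inner_sub_right, inner_smul_right, hφφ, mul_one, sub_self]
  have hco := coercive_hamiltonian hN hC hM hJ hγ hγM hφ hy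
  have hHy : hamiltonian J γ p - (E : ℂ) • p
      = hamiltonian J γ (p - β • φ) - (E : ℂ) • (p - β • φ) := by
    rw [map_sub, map_smul, hφ.2.1]
    module
  set y := p - β • φ with hydef
  -- the part of `p` orthogonal to `φ` carries all the excess energy, so it vanishes
  have hpy : (inner ℂ p (hamiltonian J γ p - (E : ℂ) • p)).re
      = (inner ℂ y (hamiltonian J γ y)).re - E * ‖y‖ ^ 2 := by
    have h0 : inner ℂ φ (hamiltonian J γ y) = 0 := by
      have := hamiltonian_isSymmetric J γ φ y
      simp only [ContinuousLinearMap.coe_coe] at this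
      rw [← this, hφ.2.1, inner_smul_left, hy, mul_zero]
    have hpdec : p = β • φ + y := by rw [hydef]; abel
    rw [hHy]
    nth_rewrite 1 [hpdec]
    rw [inner_add_left, inner_smul_left, inner_sub_right, h0, inner_smul_right, hy, mul_zero,
      sub_zero, mul_zero, zero_add, inner_sub_right, Complex.sub_re, re_inner_ofReal_smul_self]
  have hpp : (inner ℂ p (hamiltonian J γ p - (E : ℂ) • p)).re
      = (inner ℂ p (hamiltonian J γ p)).re - E := by
    rw [inner_sub_right, Complex.sub_re, re_inner_ofReal_smul_self, hp1]
    ring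
  have hD := gapBound_pos hN (gapRate C M) hγ
  have hy0 : y = 0 := by
    by_contra h
    have : 0 < ‖y‖ ^ 2 := by positivity
    nlinarith
  have hHp : hamiltonian J γ p = (E : ℂ) • p := by
    rw [hy0] at hHy
    simpa [sub_eq_zero] using hHy
  exact ⟨E, p, ⟨hp1, hHp, hφ.2.2⟩, fun s => by simp [hp, modulus]⟩

end Gap

/-! ### Perturbation theory of a gapped ground state -/

section Perturbation

variable {V : Type*} [NormedAddCommGroup V] [InnerProductSpace ℂ V]

/-- A product with one factor differentiable and vanishing at `x` is differentiable at `x` as soon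
as the other factor is continuous there. -/
theorem hasDerivAt_bilinear_of_eq_zero {F G W : Type*} [NormedAddCommGroup F] [NormedSpace ℝ F]
    [NormedAddCommGroup G] [NormedSpace ℝ G] [NormedAddCommGroup W] [NormedSpace ℝ W]
    {B : F × G → W} (hB : IsBoundedBilinearMap ℝ B) {f : ℝ → F} {g : ℝ → G} {f' : F} {x : ℝ}
    (hf : HasDerivAt f f' x) (hfx : f x = 0) (hg : ContinuousAt g x) :
    HasDerivAt (fun t => B (f t, g t)) (B (f', g x)) x := by
  rw [hasDerivAt_iff_tendsto_slope] at hf ⊢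
  have h1 : Tendsto (fun t => (slope f x t, g t)) (𝓝[≠] x) (𝓝 (f', g x)) :=
    hf.prodMk_nhds (hg.tendsto.mono_left nhdsWithin_le_nhds)
  have h2 := (hB.continuous.tendsto (f', g x)).comp h1
  refine h2.congr fun t => ?_
  have h0 : B (0, g x) = 0 := by
    have := hB.smul_left 0 0 (g x)
    simpa using this
  simp only [Function.comp, slope_def_module, hfx, sub_zero, h0]
  rw [hB.smul_left]

theorem inner_sub_proj_eq {T : V →L[ℂ] V} (hT : (T : V →ₗ[ℂ] V).IsSymmetric) {φ : V} {E : ℝ}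
    (hE : T φ = (E : ℂ) • φ) (v : V) :
    inner ℂ v (T v - (E : ℂ) • v) = inner ℂ (v - inner ℂ φ v • φ)
      (T (v - inner ℂ φ v • φ) - (E : ℂ) • (v - inner ℂ φ v • φ)) := by
  have h1 : T (v - inner ℂ φ v • φ) - (E : ℂ) • (v - inner ℂ φ v • φ) = T v - (E : ℂ) • v := by
    rw [map_sub, map_smul, hE]; module
  have h2 : inner ℂ φ (T v - (E : ℂ) • v) = 0 := by
    have := hT φ v
    simp only [ContinuousLinearMap.coe_coe] at this
    rw [inner_sub_right, ← this, hE, inner_smul_left, inner_smul_right, Complex.conj_ofReal,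
      sub_self]
  rw [h1, inner_sub_left, inner_smul_left, h2, mul_zero, sub_zero]

theorem inner_sub_proj_right {φ : V} (hφ : ‖φ‖ = 1) (v : V) :
    inner ℂ φ (v - inner ℂ φ v • φ) = 0 := by
  rw [inner_sub_right, inner_smul_right, inner_self_of_norm_eq_one hφ, mul_one, sub_self]

theorem norm_sq_eq_add_proj {φ : V} (hφ : ‖φ‖ = 1) (v : V) :
    ‖v‖ ^ 2 = ‖inner ℂ φ v‖ ^ 2 + ‖v - inner ℂ φ v • φ‖ ^ 2 := by
  have h := norm_add_sq_eq_norm_sq_add_norm_sq_of_inner_eq_zero (𝕜 := ℂ) (inner ℂ φ v • φ)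
    (v - inner ℂ φ v • φ) (by rw [inner_smul_left, inner_sub_proj_right hφ, mul_zero])
  rw [add_sub_cancel, norm_smul, hφ, mul_one] at h
  nlinarith

/-- An isolated simple lowest eigenvalue `E` of a symmetric operator `T`, with unit eigenvector
`φ` and a gap of at least `D` above it. -/
structure IsGapped (T : V →L[ℂ] V) (E D : ℝ) (φ : V) : Prop where
  symm : (T : V →ₗ[ℂ] V).IsSymmetric
  norm_eq : ‖φ‖ = 1
  eigen : T φ = (E : ℂ) • φ
  pos : 0 < D
  coercive : ∀ y, inner ℂ φ y = 0 → (E + D) * ‖y‖ ^ 2 ≤ (inner ℂ y (T y)).re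

namespace IsGapped

variable {T : V →L[ℂ] V} {E D : ℝ} {φ : V}

theorem le_re_inner (h : IsGapped T E D φ) {y : V} (hy : inner ℂ φ y = 0) :
    D * ‖y‖ ^ 2 ≤ (inner ℂ y (T y - (E : ℂ) • y)).re := by
  rw [inner_sub_right, Complex.sub_re, re_inner_ofReal_smul_self]
  linarith [h.coercive y hy]

theorem le_energy (h : IsGapped T E D φ) (v : V) : E * ‖v‖ ^ 2 ≤ (inner ℂ v (T v)).re := by
  have h1 := h.le_re_inner (inner_sub_proj_right h.norm_eq v)
  rw [← inner_sub_proj_eq h.symm h.eigen, inner_sub_right, Complex.sub_re,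
    re_inner_ofReal_smul_self] at h1
  have : 0 ≤ D * ‖v - inner ℂ φ v • φ‖ ^ 2 := mul_nonneg h.pos.le (sq_nonneg _)
  linarith

theorem mul_norm_le (h : IsGapped T E D φ) {y : V} (hy : inner ℂ φ y = 0) :
    D * ‖y‖ ≤ ‖T y - (E : ℂ) • y‖ := by
  rcases (norm_nonneg y).eq_or_lt with h0 | h0
  · rw [← h0, mul_zero]; exact norm_nonneg _
  · have h1 := (h.le_re_inner hy).trans ((Complex.re_le_norm _).trans (norm_inner_le_norm _ _))
    refine le_of_mul_le_mul_left ?_ h0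
    linarith

/-- The reduced resolvent: the inverse of `T - E` on the orthogonal complement of `φ`, extended by
zero to the line of `φ`. -/
theorem exists_reducedResolvent [FiniteDimensional ℂ V] (h : IsGapped T E D φ) :
    ∃ R : V →L[ℂ] V, (∀ u, inner ℂ φ (R u) = 0) ∧
      (∀ u, T (R u) - (E : ℂ) • R u = u - inner ℂ φ u • φ) ∧
      (∀ y, R (T y - (E : ℂ) • y) = y - inner ℂ φ y • φ) ∧ ∀ u, D * ‖R u‖ ≤ ‖u‖ := by
  let G : V →L[ℂ] V := T - (E : ℂ) • ContinuousLinearMap.id ℂ V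
    + InnerProductSpace.rankOne ℂ φ φ
  have hG : ∀ v, G v = T v - (E : ℂ) • v + inner ℂ φ v • φ := fun v => by
    simp [G, InnerProductSpace.rankOne_apply]
  have hsymm : ∀ v, inner ℂ φ (T v - (E : ℂ) • v) = 0 := fun v => by
    have := h.symm φ v
    simp only [ContinuousLinearMap.coe_coe] at this
    rw [inner_sub_right, ← this, h.eigen, inner_smul_left, inner_smul_right, Complex.conj_ofReal,
      sub_self]
  have hφG : ∀ v, inner ℂ φ (G v) = inner ℂ φ v := fun v => by
    rw [hG, inner_add_right, hsymm, inner_smul_right, inner_self_of_norm_eq_one h.norm_eq]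
    ring
  have hinj : Function.Injective (G : V →ₗ[ℂ] V) := by
    rw [← LinearMap.ker_eq_bot, LinearMap.ker_eq_bot']
    intro v hv
    simp only [ContinuousLinearMap.coe_coe] at hv
    have h1 : inner ℂ φ v = 0 := by rw [← hφG, hv, inner_zero_right]
    have h2 := h.mul_norm_le h1
    have h3 := hG v
    rw [hv, h1, zero_smul, add_zero] at h3
    rw [← h3, norm_zero] at h2
    have h4 : ‖v‖ ≤ 0 := le_of_mul_le_mul_left (by rwa [mul_zero]) h.pos
    exact norm_le_zero_iff.1 h4
  let e : V ≃ₗ[ℂ] V := LinearEquiv.ofInjectiveEndo (G : V →ₗ[ℂ] V) hinj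
  have he : ∀ v, e v = G v := fun v => rfl
  let R : V →L[ℂ] V := (LinearMap.toContinuousLinearMap (e.symm : V →ₗ[ℂ] V)) ∘L
    (ContinuousLinearMap.id ℂ V - InnerProductSpace.rankOne ℂ φ φ)
  have hR : ∀ u, R u = e.symm (u - inner ℂ φ u • φ) := fun u => by
    simp [R, InnerProductSpace.rankOne_apply]
  have hGR : ∀ u, G (R u) = u - inner ℂ φ u • φ := fun u => by
    rw [hR, ← he, LinearEquiv.apply_symm_apply]
  have horth : ∀ u, inner ℂ φ (R u) = 0 := fun u => by
    rw [← hφG, hGR, inner_sub_proj_right h.norm_eq]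
  have hTR : ∀ u, T (R u) - (E : ℂ) • R u = u - inner ℂ φ u • φ := fun u => by
    have := hGR u
    rwa [hG, horth, zero_smul, add_zero] at this
  refine ⟨R, horth, hTR, fun y => ?_, fun u => ?_⟩
  · rw [hR, hsymm, zero_smul, sub_zero, LinearEquiv.symm_apply_eq, he, hG,
      inner_sub_proj_right h.norm_eq, zero_smul, add_zero, map_sub, map_smul, h.eigen]
    module
  · refine (h.mul_norm_le (horth u)).trans ?_
    rw [hTR]
    have := norm_sq_eq_add_proj h.norm_eq u
    refine le_of_sq_le_sq ?_ (norm_nonneg u)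
    nlinarith [sq_nonneg ‖inner ℂ φ u‖]

end IsGapped

/-- A family `A - γ X` with an isolated simple ground state for every `γ ∈ I`, the phases of the
ground states `φ γ` being chosen such that all overlaps are nonnegative. -/
structure IsGappedFamily (A X : V →L[ℂ] V) (I : Set ℝ) (E D : ℝ → ℝ) (φ : ℝ → V) : Prop where
  isOpen : IsOpen I
  symm_X : (X : V →ₗ[ℂ] V).IsSymmetric
  gapped : ∀ γ ∈ I, IsGapped (A - (γ : ℂ) • X) (E γ) (D γ) (φ γ)
  continuousAt_gap : ∀ γ ∈ I, ContinuousAt D γ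
  overlap : ∀ γ ∈ I, ∀ γ' ∈ I, inner ℂ (φ γ) (φ γ') = ((‖inner ℂ (φ γ) (φ γ')‖ : ℝ) : ℂ)

namespace IsGappedFamily

variable {A X : V →L[ℂ] V} {I : Set ℝ} {E D : ℝ → ℝ} {φ : ℝ → V}

theorem energy_le (h : IsGappedFamily A X I E D φ) {γ γ' : ℝ} (hγ : γ ∈ I) (hγ' : γ' ∈ I) :
    E γ' ≤ E γ + ‖X‖ * |γ' - γ| := by
  have h1 := (h.gapped γ' hγ').le_energy (φ γ)
  have h2 : (A - (γ' : ℂ) • X) (φ γ) = (E γ : ℂ) • φ γ - ((γ' - γ : ℝ) : ℂ) • X (φ γ) := by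
    rw [← (h.gapped γ hγ).eigen]
    simp only [sub_apply, smul_apply]
    push_cast
    module
  have hn := (h.gapped γ hγ).norm_eq
  rw [h2, hn, inner_sub_right, Complex.sub_re, re_inner_ofReal_smul_self, hn, inner_smul_right,
    Complex.re_ofReal_mul] at h1
  have h3 : |(inner ℂ (φ γ) (X (φ γ))).re| ≤ ‖X‖ := by
    refine (Complex.abs_re_le_norm _).trans ((norm_inner_le_norm _ _).trans ?_)
    have := X.le_opNorm (φ γ)
    rw [hn] at this ⊢
    linarith
  have h4 := neg_abs_le ((γ' - γ) * (inner ℂ (φ γ) (X (φ γ))).re)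
  rw [abs_mul] at h4
  nlinarith [abs_nonneg (γ' - γ)]

theorem abs_energy_sub_le (h : IsGappedFamily A X I E D φ) {γ γ' : ℝ} (hγ : γ ∈ I)
    (hγ' : γ' ∈ I) : |E γ' - E γ| ≤ ‖X‖ * |γ' - γ| := by
  have h1 := h.energy_le hγ hγ'
  have h2 := h.energy_le hγ' hγ
  rw [abs_sub_comm γ γ'] at h2
  rw [abs_le]
  constructor <;> linarith

theorem eventually_mem (h : IsGappedFamily A X I E D φ) {γ₀ : ℝ} (hγ₀ : γ₀ ∈ I) :
    ∀ᶠ γ in 𝓝 γ₀, γ ∈ I := h.isOpen.mem_nhds hγ₀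

theorem continuousAt_energy (h : IsGappedFamily A X I E D φ) {γ₀ : ℝ} (hγ₀ : γ₀ ∈ I) :
    ContinuousAt E γ₀ := by
  rw [ContinuousAt, tendsto_iff_norm_sub_tendsto_zero]
  have hc : Tendsto (fun γ => ‖X‖ * |γ - γ₀|) (𝓝 γ₀) (𝓝 0) := by
    have : ContinuousAt (fun γ => ‖X‖ * |γ - γ₀|) γ₀ := by fun_prop
    simpa [ContinuousAt] using this
  refine squeeze_zero' (Eventually.of_forall fun _ => norm_nonneg _) ?_ hc
  filter_upwards [h.eventually_mem hγ₀] with γ hγ using h.abs_energy_sub_le hγ₀ hγ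

/-- How a vector fails to solve an equation at `γ₀` if it solves it at `γ`. -/
theorem apply_sub_energy (γ₀ γ : ℝ) (v : V) :
    (A - (γ₀ : ℂ) • X) v - (E γ₀ : ℂ) • v = ((A - (γ : ℂ) • X) v - (E γ : ℂ) • v)
      + ((γ - γ₀) • X v + (E γ - E γ₀) • v) := by
  simp only [sub_apply, smul_apply, ← Complex.coe_smul]
  push_cast
  module

/-- The part of `φ γ` orthogonal to `φ γ₀` is of first order in `γ - γ₀`. -/
theorem mul_norm_sub_proj_le (h : IsGappedFamily A X I E D φ) {γ₀ γ : ℝ} (hγ₀ : γ₀ ∈ I)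
    (hγ : γ ∈ I) :
    D γ₀ * ‖φ γ - inner ℂ (φ γ₀) (φ γ) • φ γ₀‖ ≤ 2 * ‖X‖ * |γ - γ₀| := by
  have g₀ := h.gapped γ₀ hγ₀
  have g := h.gapped γ hγ
  refine (g₀.mul_norm_le (inner_sub_proj_right g₀.norm_eq _)).trans ?_
  have h1 : (A - (γ₀ : ℂ) • X) (φ γ - inner ℂ (φ γ₀) (φ γ) • φ γ₀)
      - (E γ₀ : ℂ) • (φ γ - inner ℂ (φ γ₀) (φ γ) • φ γ₀)
      = (γ - γ₀) • X (φ γ) + (E γ - E γ₀) • φ γ := by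
    have h2 := apply_sub_energy (A := A) (X := X) (E := E) γ₀ γ (φ γ)
    rw [g.eigen, sub_self, zero_add] at h2
    rw [← h2, map_sub, map_smul, g₀.eigen]
    module
  rw [h1]
  refine (norm_add_le _ _).trans ?_
  rw [norm_smul, norm_smul, g.norm_eq, Real.norm_eq_abs, Real.norm_eq_abs]
  have h3 := X.le_opNorm (φ γ)
  rw [g.norm_eq] at h3
  nlinarith [h.abs_energy_sub_le hγ₀ hγ, abs_nonneg (γ - γ₀)]

theorem abs_overlap_sub_one_le (h : IsGappedFamily A X I E D φ) {γ₀ γ : ℝ} (hγ₀ : γ₀ ∈ I)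
    (hγ : γ ∈ I) :
    ‖‖inner ℂ (φ γ₀) (φ γ)‖ - 1‖ ≤ (2 * ‖X‖ / D γ₀) ^ 2 * ‖(γ - γ₀) ^ 2‖ := by
  have g₀ := h.gapped γ₀ hγ₀
  have h1 := h.mul_norm_sub_proj_le hγ₀ hγ
  have h2 := norm_sq_eq_add_proj g₀.norm_eq (φ γ)
  rw [(h.gapped γ hγ).norm_eq] at h2
  set r := ‖inner ℂ (φ γ₀) (φ γ)‖
  set z := ‖φ γ - inner ℂ (φ γ₀) (φ γ) • φ γ₀‖
  have hr : 0 ≤ r := norm_nonneg _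
  have hr1 : r ≤ 1 := by nlinarith [sq_nonneg z]
  have hz : z ≤ 2 * ‖X‖ / D γ₀ * |γ - γ₀| := by
    rw [div_mul_eq_mul_div, le_div_iff₀ g₀.pos]; linarith
  have hz2 : z ^ 2 ≤ (2 * ‖X‖ / D γ₀ * |γ - γ₀|) ^ 2 := by
    have : 0 ≤ z := norm_nonneg _
    gcongr
  rw [norm_pow, Real.norm_eq_abs, Real.norm_eq_abs, abs_of_nonpos (by linarith), ← mul_pow]
  nlinarith

theorem hasDerivAt_overlap (h : IsGappedFamily A X I E D φ) {γ₀ : ℝ} (hγ₀ : γ₀ ∈ I) :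
    HasDerivAt (fun γ => ‖inner ℂ (φ γ₀) (φ γ)‖) 0 γ₀ := by
  have h1 : (‖inner ℂ (φ γ₀) (φ γ₀)‖ : ℝ) = 1 := by
    rw [inner_self_of_norm_eq_one (h.gapped γ₀ hγ₀).norm_eq, norm_one]
  rw [hasDerivAt_iff_isLittleO]
  simp only [smul_zero, sub_zero, h1]
  refine (Asymptotics.IsBigO.of_bound ((2 * ‖X‖ / D γ₀) ^ 2) ?_).trans_isLittleO
    (g := fun γ => (γ - γ₀) ^ 2) ?_
  · filter_upwards [h.eventually_mem hγ₀] with γ hγ using h.abs_overlap_sub_one_le hγ₀ hγ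
  · have := (Asymptotics.isLittleO_pow_id (𝕜 := ℝ) (n := 2) (by norm_num)).comp_tendsto
      (show Tendsto (fun γ : ℝ => γ - γ₀) (𝓝 γ₀) (𝓝 0) by
        have : ContinuousAt (fun γ : ℝ => γ - γ₀) γ₀ := by fun_prop
        simpa [ContinuousAt] using this)
    exact this

theorem continuousAt_groundState (h : IsGappedFamily A X I E D φ) {γ₀ : ℝ} (hγ₀ : γ₀ ∈ I) :
    ContinuousAt φ γ₀ := by
  have g₀ := h.gapped γ₀ hγ₀
  have h1 : Tendsto (fun γ => φ γ - inner ℂ (φ γ₀) (φ γ) • φ γ₀) (𝓝 γ₀) (𝓝 0) := by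
    rw [tendsto_zero_iff_norm_tendsto_zero]
    have hc : Tendsto (fun γ => 2 * ‖X‖ * |γ - γ₀| / D γ₀) (𝓝 γ₀) (𝓝 0) := by
      have : ContinuousAt (fun γ => 2 * ‖X‖ * |γ - γ₀| / D γ₀) γ₀ := by fun_prop
      simpa [ContinuousAt] using this
    refine squeeze_zero' (Eventually.of_forall fun _ => norm_nonneg _) ?_ hc
    filter_upwards [h.eventually_mem hγ₀] with γ hγ
    rw [le_div_iff₀ g₀.pos, mul_comm]
    exact h.mul_norm_sub_proj_le hγ₀ hγ
  have h2 := (h.hasDerivAt_overlap hγ₀).continuousAt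
  have h3 : Tendsto (fun γ => ‖inner ℂ (φ γ₀) (φ γ)‖ • φ γ₀) (𝓝 γ₀) (𝓝 (φ γ₀)) := by
    have : ContinuousAt (fun γ => ‖inner ℂ (φ γ₀) (φ γ)‖ • φ γ₀) γ₀ := h2.smul continuousAt_const
    have h4 : ‖inner ℂ (φ γ₀) (φ γ₀)‖ = 1 := by
      rw [inner_self_of_norm_eq_one g₀.norm_eq, norm_one]
    simpa only [ContinuousAt, h4, one_smul] using this
  have h5 := h1.add h3
  rw [zero_add] at h5
  refine h5.congr' ?_
  filter_upwards [h.eventually_mem hγ₀] with γ hγ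
  rw [← Complex.coe_smul, ← h.overlap γ₀ hγ₀ γ hγ]
  abel

theorem re_inner_eq_zero (h : IsGappedFamily A X I E D φ) {γ₀ γ : ℝ} (hγ₀ : γ₀ ∈ I)
    (hγ : γ ∈ I) : (γ - γ₀) * (inner ℂ (φ γ₀) (X (φ γ))).re
      + (E γ - E γ₀) * ‖inner ℂ (φ γ₀) (φ γ)‖ = 0 := by
  have g₀ := h.gapped γ₀ hγ₀
  have h1 := apply_sub_energy (A := A) (X := X) (E := E) γ₀ γ (φ γ)
  rw [(h.gapped γ hγ).eigen, sub_self, zero_add] at h1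
  have h2 := congrArg (fun v => (inner ℂ (φ γ₀) v).re) h1
  have h3 := g₀.symm (φ γ₀) (φ γ)
  simp only [ContinuousLinearMap.coe_coe] at h3
  simp only [inner_sub_right, ← h3, g₀.eigen, inner_smul_left, inner_smul_right,
    Complex.conj_ofReal, sub_self, inner_add_right, Complex.add_re, ← Complex.coe_smul] at h2
  rw [h.overlap γ₀ hγ₀ γ hγ, ← Complex.ofReal_mul, Complex.ofReal_re, Complex.re_ofReal_mul] at h2
  simpa using h2.symm

/-- The Hellmann–Feynman formula. -/
theorem hasDerivAt_energy (h : IsGappedFamily A X I E D φ) {γ₀ : ℝ} (hγ₀ : γ₀ ∈ I) :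
    HasDerivAt E (-(inner ℂ (φ γ₀) (X (φ γ₀))).re) γ₀ := by
  have g₀ := h.gapped γ₀ hγ₀
  have hφ := h.continuousAt_groundState hγ₀
  have hr := (h.hasDerivAt_overlap hγ₀).continuousAt
  have h4 : ‖inner ℂ (φ γ₀) (φ γ₀)‖ = 1 := by
    rw [inner_self_of_norm_eq_one g₀.norm_eq, norm_one]
  have hcont : ContinuousAt
      (fun γ => -(inner ℂ (φ γ₀) (X (φ γ))).re / ‖inner ℂ (φ γ₀) (φ γ)‖) γ₀ := by
    refine ContinuousAt.div ?_ hr (by rw [h4]; exact one_ne_zero)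
    exact (Complex.continuous_re.continuousAt.comp
      (continuousAt_const.inner (X.continuous.continuousAt.comp hφ))).neg
  have hid : HasDerivAt (fun γ : ℝ => γ - γ₀) 1 γ₀ := (hasDerivAt_id γ₀).sub_const γ₀
  have h5 := hasDerivAt_bilinear_of_eq_zero (isBoundedBilinearMap_smul (𝕜 := ℝ) (A := ℝ) (E := ℝ))
    hid (sub_self γ₀) hcont
  have h6 := h5.const_add (E γ₀)
  simp only [h4, div_one, smul_eq_mul, one_mul] at h6
  refine h6.congr_of_eventuallyEq ?_
  have hpos : ∀ᶠ γ in 𝓝 γ₀, 0 < ‖inner ℂ (φ γ₀) (φ γ)‖ := by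
    refine hr.eventually_const_lt ?_
    simp only [h4, zero_lt_one]
  filter_upwards [h.eventually_mem hγ₀, hpos] with γ hγ hγ0
  have := h.re_inner_eq_zero hγ₀ hγ
  field_simp
  linarith

/-- Two first-order terms of perturbation theory: differentiability at a point where the
increments of `γ` and of the energy vanish needs no differentiability of `y`. -/
theorem hasDerivAt_increment (h : IsGappedFamily A X I E D φ) {γ₀ : ℝ} (hγ₀ : γ₀ ∈ I)
    {y : ℝ → V} (hy : ContinuousAt y γ₀) :
    HasDerivAt (fun γ => (γ - γ₀) • X (y γ) + (E γ - E γ₀) • y γ)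
      (X (y γ₀) - (inner ℂ (φ γ₀) (X (φ γ₀))).re • y γ₀) γ₀ := by
  have hid : HasDerivAt (fun γ : ℝ => γ - γ₀) 1 γ₀ := (hasDerivAt_id γ₀).sub_const γ₀
  have h1 := hasDerivAt_bilinear_of_eq_zero (isBoundedBilinearMap_smul (𝕜 := ℝ) (A := ℝ) (E := V))
    hid (sub_self γ₀) (X.continuous.continuousAt.comp hy)
  have h2 := hasDerivAt_bilinear_of_eq_zero (isBoundedBilinearMap_smul (𝕜 := ℝ) (A := ℝ) (E := V))
    ((h.hasDerivAt_energy hγ₀).sub_const (E γ₀)) (sub_self _) hy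
  have h3 := h1.add h2
  simp only [one_smul, neg_smul, Function.comp, ← sub_eq_add_neg] at h3
  exact h3

theorem hasDerivAt_clm (T : V →L[ℂ] V) {f : ℝ → V} {f' : V} {x : ℝ} (hf : HasDerivAt f f' x) :
    HasDerivAt (fun t => T (f t)) (T f') x :=
  (T.restrictScalars ℝ).hasFDerivAt.comp_hasDerivAt x hf

/-- First-order perturbation theory for the ground state. -/
theorem hasDerivAt_groundState (h : IsGappedFamily A X I E D φ) {γ₀ : ℝ} (hγ₀ : γ₀ ∈ I)
    {R : V →L[ℂ] V} (hR : ∀ y, R ((A - (γ₀ : ℂ) • X) y - (E γ₀ : ℂ) • y)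
      = y - inner ℂ (φ γ₀) y • φ γ₀) :
    HasDerivAt φ (R (X (φ γ₀) - (inner ℂ (φ γ₀) (X (φ γ₀))).re • φ γ₀)) γ₀ := by
  have h1 := hasDerivAt_clm R (h.hasDerivAt_increment hγ₀ (h.continuousAt_groundState hγ₀))
  have h2 := (h.hasDerivAt_overlap hγ₀).smul_const (φ γ₀)
  have h3 := h1.add h2
  rw [zero_smul, add_zero] at h3
  refine h3.congr_of_eventuallyEq ?_
  filter_upwards [h.eventually_mem hγ₀] with γ hγ
  have h4 := apply_sub_energy (A := A) (X := X) (E := E) γ₀ γ (φ γ)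
  rw [(h.gapped γ hγ).eigen, sub_self, zero_add] at h4
  simp only [Pi.add_apply]
  rw [← h4, hR, ← Complex.coe_smul, ← h.overlap γ₀ hγ₀ γ hγ]
  abel

/-- The orthogonal solution `y` of `(A - γ X - E) y = u` depends differentiably on `γ` if `u`
does. -/
theorem hasDerivAt_solution (h : IsGappedFamily A X I E D φ) {γ₀ : ℝ} (hγ₀ : γ₀ ∈ I)
    {R : V →L[ℂ] V} (hR : ∀ y, R ((A - (γ₀ : ℂ) • X) y - (E γ₀ : ℂ) • y)
      = y - inner ℂ (φ γ₀) y • φ γ₀) {y u : ℝ → V} {u' φ' : V}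
    (hy : ∀ γ ∈ I, inner ℂ (φ γ) (y γ) = 0)
    (hyu : ∀ γ ∈ I, (A - (γ : ℂ) • X) (y γ) - (E γ : ℂ) • y γ = u γ)
    (hu : HasDerivAt u u' γ₀) (hφ : HasDerivAt φ φ' γ₀) :
    HasDerivAt y (R u' + R (X (y γ₀) - (inner ℂ (φ γ₀) (X (φ γ₀))).re • y γ₀)
      - inner ℂ φ' (y γ₀) • φ γ₀) γ₀ := by
  have g₀ := h.gapped γ₀ hγ₀
  have hdec : ∀ γ ∈ I, y γ = R (u γ) + R ((γ - γ₀) • X (y γ) + (E γ - E γ₀) • y γ)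
      - inner ℂ (φ γ - φ γ₀) (y γ) • φ γ₀ := by
    intro γ hγ
    have h1 := apply_sub_energy (A := A) (X := X) (E := E) γ₀ γ (y γ)
    rw [hyu γ hγ] at h1
    rw [← map_add, ← h1, hR, inner_sub_left, hy γ hγ, zero_sub, neg_smul]
    abel
  -- the solutions are bounded near `γ₀`, hence continuous at `γ₀` by `hdec`
  have hbdd : ∀ᶠ γ in 𝓝 γ₀, ‖y γ‖ ≤ (‖u γ₀‖ + 1) / (D γ₀ / 2) := by
    have hD : ∀ᶠ γ in 𝓝 γ₀, D γ₀ / 2 < D γ :=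
      (h.continuousAt_gap γ₀ hγ₀).eventually_const_lt (by linarith [g₀.pos])
    have hU : ∀ᶠ γ in 𝓝 γ₀, ‖u γ‖ < ‖u γ₀‖ + 1 :=
      hu.continuousAt.norm.eventually_lt_const (by linarith)
    filter_upwards [h.eventually_mem hγ₀, hD, hU] with γ hγ hDγ hUγ
    have h1 := (h.gapped γ hγ).mul_norm_le (hy γ hγ)
    rw [hyu γ hγ] at h1
    rw [le_div_iff₀ (by linarith [g₀.pos])]
    nlinarith [norm_nonneg (y γ)]
  set K := (‖u γ₀‖ + 1) / (D γ₀ / 2) with hK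
  have hcont : ContinuousAt y γ₀ := by
    rw [ContinuousAt, tendsto_iff_norm_sub_tendsto_zero]
    have hc : Tendsto (fun γ => ‖R‖ * (‖u γ - u γ₀‖ + (|γ - γ₀| * (‖X‖ * K) + |E γ - E γ₀| * K))
        + ‖φ γ - φ γ₀‖ * K) (𝓝 γ₀) (𝓝 0) := by
      have h1 := hu.continuousAt
      have h2 := hφ.continuousAt
      have h3 := h.continuousAt_energy hγ₀
      have : ContinuousAt (fun γ => ‖R‖ * (‖u γ - u γ₀‖ +
          (|γ - γ₀| * (‖X‖ * K) + |E γ - E γ₀| * K)) + ‖φ γ - φ γ₀‖ * K) γ₀ := by fun_prop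
      simpa [ContinuousAt] using this
    refine squeeze_zero' (Eventually.of_forall fun _ => norm_nonneg _) ?_ hc
    filter_upwards [h.eventually_mem hγ₀, hbdd] with γ hγ hb
    have h0 := hdec γ₀ hγ₀
    simp only [sub_self, zero_smul, add_zero, map_zero, inner_zero_left, sub_zero] at h0
    have hdiff : y γ - y γ₀ = R ((u γ - u γ₀) + ((γ - γ₀) • X (y γ) + (E γ - E γ₀) • y γ))
        - inner ℂ (φ γ - φ γ₀) (y γ) • φ γ₀ := by
      rw [map_add, map_sub, ← h0]
      nth_rewrite 1 [hdec γ hγ]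
      abel
    rw [hdiff]
    refine (norm_sub_le _ _).trans (add_le_add ?_ ?_)
    · refine (R.le_opNorm _).trans ?_
      refine mul_le_mul_of_nonneg_left ?_ (norm_nonneg _)
      refine (norm_add_le _ _).trans (add_le_add le_rfl ?_)
      refine (norm_add_le _ _).trans ?_
      rw [norm_smul, norm_smul, Real.norm_eq_abs, Real.norm_eq_abs]
      have := X.le_opNorm (y γ)
      gcongr
      exact this.trans (by gcongr)
    · rw [norm_smul, g₀.norm_eq, mul_one]
      exact (norm_inner_le_norm _ _).trans (by gcongr)
  have h1 := hasDerivAt_clm R hu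
  have h2 := hasDerivAt_clm R (h.hasDerivAt_increment hγ₀ hcont)
  have h3 := hasDerivAt_bilinear_of_eq_zero (isBoundedBilinearMap_inner (𝕜 := ℂ) (E := V))
    (hφ.sub_const (φ γ₀)) (sub_self _) hcont
  have h4 := (h1.add h2).sub (h3.smul_const (φ γ₀))
  refine h4.congr_of_eventuallyEq ?_
  filter_upwards [h.eventually_mem hγ₀] with γ hγ using hdec γ hγ

/-- Second-order control of the ground state `φ`: with `χ = φ'`, the vector `ζ` orthogonal to `φ`
that solves `(A - γ X - E) ζ = φ'` is differentiable, and `ζ` and `ζ'` are bounded by the second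
and third powers of the inverse gap. -/
theorem exists_corrector [FiniteDimensional ℂ V] (h : IsGappedFamily A X I E D φ) :
    ∃ χ ζ ζ' : ℝ → V, ∀ γ ∈ I, HasDerivAt φ (χ γ) γ ∧ HasDerivAt ζ (ζ' γ) γ ∧
      (A - (γ : ℂ) • X) (ζ γ) - (E γ : ℂ) • ζ γ = χ γ ∧
      ‖ζ γ‖ ≤ 2 * ‖X‖ / D γ ^ 2 ∧ ‖ζ' γ‖ ≤ 24 * ‖X‖ ^ 2 / D γ ^ 3 := by
  choose! R hR1 hR2 hR3 hR4 using fun γ hγ => (h.gapped γ hγ).exists_reducedResolvent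
  set e : ℝ → ℝ := fun γ => (inner ℂ (φ γ) (X (φ γ))).re with he
  set u : ℝ → V := fun γ => X (φ γ) - e γ • φ γ with hu
  set χ : ℝ → V := fun γ => R γ (u γ) with hχ
  set ζ : ℝ → V := fun γ => R γ (χ γ) with hζ
  have hXn : ∀ v : V, ‖X v‖ ≤ ‖X‖ * ‖v‖ := X.le_opNorm
  have hφχ : ∀ γ ∈ I, HasDerivAt φ (χ γ) γ := fun γ hγ => h.hasDerivAt_groundState hγ (hR3 γ hγ)
  have hee : ∀ γ ∈ I, |e γ| ≤ ‖X‖ := fun γ hγ => by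
    refine (Complex.abs_re_le_norm _).trans ((norm_inner_le_norm _ _).trans ?_)
    have := hXn (φ γ)
    rw [(h.gapped γ hγ).norm_eq] at this ⊢
    linarith
  have hreal : ∀ γ, inner ℂ (φ γ) (X (φ γ)) = (e γ : ℂ) := fun γ => by
    have h1 := h.symm_X (φ γ) (φ γ)
    simp only [ContinuousLinearMap.coe_coe] at h1
    exact (Complex.conj_eq_iff_re.1 (by rw [inner_conj_symm, h1])).symm
  have horth : ∀ γ ∈ I, inner ℂ (φ γ) (u γ) = 0 := fun γ hγ => by
    rw [hu, inner_sub_right, hreal, ← Complex.coe_smul, inner_smul_right,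
      inner_self_of_norm_eq_one (h.gapped γ hγ).norm_eq, mul_one, sub_self]
  have hχu : ∀ γ ∈ I, (A - (γ : ℂ) • X) (χ γ) - (E γ : ℂ) • χ γ = u γ := fun γ hγ => by
    rw [hR2 γ hγ, horth γ hγ, zero_smul, sub_zero]
  have hζχ : ∀ γ ∈ I, (A - (γ : ℂ) • X) (ζ γ) - (E γ : ℂ) • ζ γ = χ γ := fun γ hγ => by
    rw [hR2 γ hγ, hR1 γ hγ, zero_smul, sub_zero]
  set e' : ℝ → ℝ := fun γ => (inner ℂ (φ γ) (X (χ γ)) + inner ℂ (χ γ) (X (φ γ))).re with he'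
  set u' : ℝ → V := fun γ => X (χ γ) - (e γ • χ γ + e' γ • φ γ) with hu'
  have hud : ∀ γ ∈ I, HasDerivAt u (u' γ) γ := fun γ hγ => by
    have h1 := hasDerivAt_clm X (hφχ γ hγ)
    have h2 : HasDerivAt e (e' γ) γ :=
      Complex.reCLM.hasFDerivAt.comp_hasDerivAt γ ((hφχ γ hγ).inner ℂ h1)
    exact h1.sub (h2.smul (hφχ γ hγ))
  set w : ℝ → V → V := fun γ y => X y - e γ • y with hw
  set χ' : ℝ → V := fun γ => R γ (u' γ) + R γ (w γ (χ γ)) - inner ℂ (χ γ) (χ γ) • φ γ with hχ'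
  have hχd : ∀ γ ∈ I, HasDerivAt χ (χ' γ) γ := fun γ hγ =>
    h.hasDerivAt_solution hγ (hR3 γ hγ) (fun γ hγ => hR1 γ hγ _) hχu (hud γ hγ) (hφχ γ hγ)
  refine ⟨χ, ζ, fun γ => R γ (χ' γ) + R γ (w γ (ζ γ)) - inner ℂ (χ γ) (ζ γ) • φ γ, fun γ hγ =>
    ⟨hφχ γ hγ, h.hasDerivAt_solution hγ (hR3 γ hγ) (fun γ hγ => hR1 γ hγ _) hζχ (hχd γ hγ)
      (hφχ γ hγ), hζχ γ hγ, ?_⟩⟩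
  have hD := (h.gapped γ hγ).pos
  have hn := (h.gapped γ hγ).norm_eq
  have hx := norm_nonneg X
  have hRn : ∀ v, ‖R γ v‖ ≤ ‖v‖ / D γ := fun v => by
    rw [le_div_iff₀ hD, mul_comm]; exact hR4 γ hγ v
  have hwn : ∀ v, ‖w γ v‖ ≤ 2 * ‖X‖ * ‖v‖ := fun v => by
    refine (norm_sub_le _ _).trans ?_
    rw [norm_smul, Real.norm_eq_abs]
    nlinarith [hXn v, mul_le_mul_of_nonneg_right (hee γ hγ) (norm_nonneg v)]
  have hun : ‖u γ‖ ≤ 2 * ‖X‖ := by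
    have := hwn (φ γ)
    rwa [hn, mul_one] at this
  have hχn : ‖χ γ‖ ≤ 2 * ‖X‖ / D γ := (hRn _).trans (by gcongr)
  have hζn : ‖ζ γ‖ ≤ 2 * ‖X‖ / D γ ^ 2 := by
    refine (hRn _).trans ?_
    rw [pow_two, ← div_div]
    gcongr
  refine ⟨hζn, ?_⟩
  have he'n : |e' γ| ≤ 2 * ‖X‖ * ‖χ γ‖ := by
    refine (Complex.abs_re_le_norm _).trans ((norm_add_le _ _).trans ?_)
    have h1 := (norm_inner_le_norm (𝕜 := ℂ) (φ γ) (X (χ γ)))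
    have h2 := (norm_inner_le_norm (𝕜 := ℂ) (χ γ) (X (φ γ)))
    have h3 := hXn (φ γ)
    rw [hn] at h1 h3
    nlinarith [hXn (χ γ), norm_nonneg (χ γ)]
  have hu'n : ‖u' γ‖ ≤ 4 * ‖X‖ * ‖χ γ‖ := by
    refine (norm_sub_le _ _).trans ?_
    have h1 := norm_add_le (e γ • χ γ) (e' γ • φ γ)
    rw [norm_smul, norm_smul, hn, mul_one, Real.norm_eq_abs, Real.norm_eq_abs] at h1
    nlinarith [hXn (χ γ), mul_le_mul_of_nonneg_right (hee γ hγ) (norm_nonneg (χ γ))]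
  have hχ'n : ‖χ' γ‖ ≤ 16 * ‖X‖ ^ 2 / D γ ^ 2 := by
    calc ‖χ' γ‖ ≤ ‖R γ (u' γ)‖ + ‖R γ (w γ (χ γ))‖ + ‖inner ℂ (χ γ) (χ γ) • φ γ‖ :=
          (norm_sub_le _ _).trans (add_le_add_left (norm_add_le _ _) _)
      _ ≤ 4 * ‖X‖ * (2 * ‖X‖ / D γ) / D γ + 2 * ‖X‖ * (2 * ‖X‖ / D γ) / D γ
          + (2 * ‖X‖ / D γ) * (2 * ‖X‖ / D γ) := by
        refine add_le_add (add_le_add ?_ ?_) ?_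
        · refine (hRn _).trans ?_
          gcongr
          exact hu'n.trans (by gcongr)
        · refine (hRn _).trans ?_
          gcongr
          exact (hwn _).trans (by gcongr)
        · rw [norm_smul, hn, mul_one]
          exact (norm_inner_le_norm _ _).trans (by gcongr)
      _ = 16 * ‖X‖ ^ 2 / D γ ^ 2 := by field_simp; ring
  calc ‖R γ (χ' γ) + R γ (w γ (ζ γ)) - inner ℂ (χ γ) (ζ γ) • φ γ‖
      ≤ ‖R γ (χ' γ)‖ + ‖R γ (w γ (ζ γ))‖ + ‖inner ℂ (χ γ) (ζ γ) • φ γ‖ :=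
        (norm_sub_le _ _).trans (add_le_add_left (norm_add_le _ _) _)
    _ ≤ 16 * ‖X‖ ^ 2 / D γ ^ 2 / D γ + 2 * ‖X‖ * (2 * ‖X‖ / D γ ^ 2) / D γ
        + (2 * ‖X‖ / D γ) * (2 * ‖X‖ / D γ ^ 2) := by
      refine add_le_add (add_le_add ?_ ?_) ?_
      · refine (hRn _).trans ?_
        gcongr
      · refine (hRn _).trans ?_
        gcongr
        exact (hwn _).trans (by gcongr)
      · rw [norm_smul, hn, mul_one]
        exact (norm_inner_le_norm _ _).trans (by gcongr)
    _ = 24 * ‖X‖ ^ 2 / D γ ^ 3 := by field_simp; ring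

end IsGappedFamily

end Perturbation

/-! ### Approximate solutions of the Schrödinger equation -/

section Schrodinger

variable {V : Type*} [NormedAddCommGroup V] [InnerProductSpace ℂ V]

theorem re_inner_neg_I_smul {T : V →L[ℂ] V} (hT : (T : V →ₗ[ℂ] V).IsSymmetric) (v : V) :
    (inner ℂ v (-Complex.I • T v)).re = 0 := by
  have h1 : (inner ℂ v (T v)).im = 0 := by
    have := hT v v
    simp only [ContinuousLinearMap.coe_coe] at this
    exact Complex.conj_eq_iff_im.1 (by rw [inner_conj_symm, this])
  rw [inner_smul_right]
  simp [h1]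

theorem monotoneOn_Ici_of_hasDerivWithinAt {f f' : ℝ → ℝ}
    (hf : ∀ t, 0 ≤ t → HasDerivWithinAt f (f' t) (Ici 0) t) (hf' : ∀ t, 0 ≤ t → 0 ≤ f' t) :
    MonotoneOn f (Ici 0) := by
  refine monotoneOn_of_hasDerivWithinAt_nonneg (convex_Ici 0)
    (fun t ht => (hf t ht).continuousWithinAt) (f' := f') ?_ ?_
  · intro t ht
    exact (hf t (interior_subset ht)).mono interior_subset
  · intro t ht
    exact hf' t (interior_subset ht)

/-- Duhamel bound: a source term `h` in the Schrödinger equation increases the norm of the solution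
at rate at most `‖h‖`. -/
theorem norm_le_of_schrodinger_source {T : ℝ → V →L[ℂ] V}
    (hT : ∀ t, 0 ≤ t → ((T t : V →L[ℂ] V) : V →ₗ[ℂ] V).IsSymmetric) {v h : ℝ → V} {B B' : ℝ → ℝ}
    (hv : ∀ t, 0 ≤ t → HasDerivWithinAt v (-Complex.I • T t (v t) + h t) (Ici 0) t)
    (hB : ∀ t, 0 ≤ t → HasDerivWithinAt B (B' t) (Ici 0) t) (hh : ∀ t, 0 ≤ t → ‖h t‖ ≤ B' t)
    {t : ℝ} (ht : 0 ≤ t) : ‖v t‖ ≤ ‖v 0‖ + (B t - B 0) := by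
  refine le_of_forall_pos_le_add fun ε hε => ?_
  -- the norm is regularized, since it is not differentiable where `v` vanishes
  set n : ℝ → ℝ := fun t => √(‖v t‖ ^ 2 + ε ^ 2) with hn
  have hpos : ∀ t, 0 < ‖v t‖ ^ 2 + ε ^ 2 := fun t => by positivity
  have hle : ∀ t, ‖v t‖ ≤ n t := fun t => Real.le_sqrt_of_sq_le (by nlinarith [sq_nonneg ε])
  have hd : ∀ t, 0 ≤ t →
      HasDerivWithinAt n (2 * (inner ℂ (v t) (h t)).re / (2 * n t)) (Ici 0) t := by
    intro t ht
    have h1 := (hv t ht).inner ℂ (hv t ht)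
    have h2 := Complex.reCLM.hasFDerivAt.comp_hasDerivWithinAt t h1
    have h3 : HasDerivWithinAt (fun t => ‖v t‖ ^ 2) (2 * (inner ℂ (v t) (h t)).re) (Ici 0) t := by
      have h4 : (fun t => ‖v t‖ ^ 2) = fun t => Complex.reCLM (inner ℂ (v t) (v t)) := by
        ext t
        have := re_inner_ofReal_smul_self (v t) 1
        simpa using this.symm
      rw [h4]
      refine h2.congr_deriv ?_
      have h5 := re_inner_neg_I_smul (hT t ht) (v t)
      rw [← inner_conj_symm (-Complex.I • T t (v t) + h t) (v t)]
      rw [Complex.reCLM_apply, Complex.add_re, Complex.conj_re, inner_add_right, Complex.add_re, h5]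
      ring
    exact (h3.add_const (ε ^ 2)).sqrt (hpos t).ne'
  have hmono := monotoneOn_Ici_of_hasDerivWithinAt (f := fun t => B t - n t)
    (fun t ht => (hB t ht).sub (hd t ht)) (fun t ht => by
      have hnpos : 0 < n t := Real.sqrt_pos.2 (hpos t)
      have h1 : (inner ℂ (v t) (h t)).re ≤ ‖v t‖ * ‖h t‖ :=
        (Complex.re_le_norm _).trans (norm_inner_le_norm _ _)
      have h2 : 2 * (inner ℂ (v t) (h t)).re / (2 * n t) ≤ B' t := by
        rw [div_le_iff₀ (by positivity)]
        nlinarith [hle t, hh t ht, norm_nonneg (v t), norm_nonneg (h t)]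
      linarith)
  have h1 := hmono (mem_Ici.2 le_rfl) (mem_Ici.2 ht) ht
  have h2 : n 0 ≤ ‖v 0‖ + ε := by
    rw [hn, Real.sqrt_le_left (by positivity)]
    nlinarith [norm_nonneg (v 0)]
  simp only at h1
  linarith [hle t]

/-- The overlap of an approximate with an exact solution varies only through the source term. -/
theorem norm_inner_sub_le {T : ℝ → V →L[ℂ] V}
    (hT : ∀ t, 0 ≤ t → ((T t : V →L[ℂ] V) : V →ₗ[ℂ] V).IsSymmetric) {w h ψ : ℝ → V} {B B' : ℝ → ℝ}
    (hw : ∀ t, 0 ≤ t → HasDerivWithinAt w (-Complex.I • T t (w t) + h t) (Ici 0) t)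
    (hψ : ∀ t, 0 ≤ t → HasDerivWithinAt ψ (-Complex.I • T t (ψ t)) (Ici 0) t)
    (hψ1 : ∀ t, 0 ≤ t → ‖ψ t‖ ≤ 1)
    (hB : ∀ t, 0 ≤ t → HasDerivWithinAt B (B' t) (Ici 0) t) (hh : ∀ t, 0 ≤ t → ‖h t‖ ≤ B' t)
    {s t : ℝ} (hs : 0 ≤ s) (hst : s ≤ t) :
    ‖inner ℂ (w t) (ψ t) - inner ℂ (w s) (ψ s)‖ ≤ B t - B s := by
  have hd : ∀ t, 0 ≤ t → HasDerivWithinAt (fun t => inner ℂ (w t) (ψ t))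
      (inner ℂ (h t) (ψ t)) (Ici 0) t := by
    intro t ht
    refine ((hw t ht).inner ℂ (hψ t ht)).congr_deriv ?_
    have := hT t ht (w t) (ψ t)
    simp only [ContinuousLinearMap.coe_coe] at this
    rw [inner_add_left, inner_smul_left, inner_smul_right, this]
    simp
  have hsub : Icc s t ⊆ Ici 0 := fun x hx => hs.trans hx.1
  have hIci : ∀ x ∈ Ico s t, Ici x ⊆ Ici 0 := fun x hx => Ici_subset_Ici.2 (hs.trans hx.1)
  refine image_norm_le_of_norm_deriv_right_le_deriv_boundary'
    (f := fun x => inner ℂ (w x) (ψ x) - inner ℂ (w s) (ψ s)) (f' := fun x => inner ℂ (h x) (ψ x))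
    (B := fun x => B x - B s) (B' := B') (a := s) (b := t) ?_ ?_ (by simp) ?_ ?_ ?_
    (right_mem_Icc.2 hst)
  · exact fun x hx => (((hd x (hsub hx)).sub_const _).continuousWithinAt).mono hsub
  · exact fun x hx => ((hd x (hs.trans hx.1)).sub_const _).mono (hIci x hx)
  · exact fun x hx => (((hB x (hsub hx)).sub_const _).continuousWithinAt).mono hsub
  · exact fun x hx => ((hB x (hs.trans hx.1)).sub_const _).mono (hIci x hx)
  · intro x hx
    have h1 := norm_inner_le_norm (𝕜 := ℂ) (h x) (ψ x)
    have h2 := hψ1 x (hs.trans hx.1)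
    nlinarith [hh x (hs.trans hx.1), norm_nonneg (h x), norm_nonneg (ψ x)]

theorem norm_eq_one_of_schrodinger {T : ℝ → V →L[ℂ] V}
    (hT : ∀ t, 0 ≤ t → ((T t : V →L[ℂ] V) : V →ₗ[ℂ] V).IsSymmetric) {ψ : ℝ → V}
    (hψ : ∀ t, 0 ≤ t → HasDerivWithinAt ψ (-Complex.I • T t (ψ t)) (Ici 0) t)
    (hψ0 : ‖ψ 0‖ = 1) {t : ℝ} (ht : 0 ≤ t) : ‖ψ t‖ = 1 := by
  have hψ' : ∀ t, 0 ≤ t →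
      HasDerivWithinAt ψ (-Complex.I • T t (ψ t) + (fun _ => (0 : V)) t) (Ici 0) t := by
    simpa using hψ
  have hB : ∀ t, 0 ≤ t → HasDerivWithinAt (fun _ : ℝ => (0 : ℝ)) 0 (Ici 0) t :=
    fun t _ => hasDerivWithinAt_const _ _ _
  have hle : ∀ t, 0 ≤ t → ‖ψ t‖ ≤ 1 := fun t ht => by
    have := norm_le_of_schrodinger_source hT hψ' hB (fun t _ => by simp) ht
    simpa [hψ0] using this
  have h1 := norm_inner_sub_le hT hψ' hψ hle hB (fun t _ => by simp) le_rfl ht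
  rw [sub_self, norm_le_zero_iff, sub_eq_zero, inner_self_of_norm_eq_one hψ0] at h1
  have h2 := re_inner_ofReal_smul_self (ψ t) 1
  rw [Complex.ofReal_one, one_smul, h1, Complex.one_re, one_mul] at h2
  nlinarith [norm_nonneg (ψ t)]

end Schrodinger

/-! ### The distance between two pure states -/

section PureStates

variable {V : Type*} [NormedAddCommGroup V] [InnerProductSpace ℂ V]

theorem norm_rankOne_sub_rankOne [CompleteSpace V] {a b : V} (ha : ‖a‖ = 1) (hb : ‖b‖ = 1) :
    ‖InnerProductSpace.rankOne ℂ a a - InnerProductSpace.rankOne ℂ b b‖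
      = √(1 - ‖inner ℂ a b‖ ^ 2) := by
  set T : V →L[ℂ] V := InnerProductSpace.rankOne ℂ a a - InnerProductSpace.rankOne ℂ b b with hT
  set q : ℝ := 1 - ‖inner ℂ a b‖ ^ 2 with hq
  have haa := inner_self_of_norm_eq_one ha
  have hbb := inner_self_of_norm_eq_one hb
  have hq0 : 0 ≤ q := by
    have := norm_inner_le_norm (𝕜 := ℂ) a b
    rw [ha, hb] at this
    rw [hq]
    nlinarith [norm_nonneg (inner ℂ a b)]
  have hqc : (q : ℂ) = 1 - inner ℂ a b * inner ℂ b a := by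
    rw [hq, ← inner_conj_symm b a, Complex.mul_conj, Complex.normSq_eq_norm_sq]
    push_cast
    ring
  have hTv : ∀ v, T v = inner ℂ a v • a - inner ℂ b v • b := fun v => by
    simp [hT, InnerProductSpace.rankOne_apply]
  have hself : IsSelfAdjoint T := by
    rw [ContinuousLinearMap.isSelfAdjoint_iff_isSymmetric]
    intro x y
    simp only [ContinuousLinearMap.coe_coe, hTv, inner_sub_left, inner_sub_right, inner_smul_left,
      inner_smul_right, inner_conj_symm]
    ring
  -- `T` squares to `q` on the span of `a` and `b`, which is its range
  have hcube : T * T * T = (q : ℂ) • T := by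
    ext v
    simp only [mul_apply_eq_comp, smul_apply, hTv, inner_sub_right, inner_smul_right, haa, hbb,
      smul_sub, smul_smul, hqc]
    module
  have h2 : ‖T * T‖ = ‖T‖ ^ 2 := by
    have := CStarRing.norm_self_mul_star (x := T)
    rwa [hself.star_eq, ← sq ‖T‖] at this
  have h4 : ‖T * T * (T * T)‖ = ‖T * T‖ ^ 2 := by
    have := CStarRing.norm_self_mul_star (x := T * T)
    rwa [star_mul, hself.star_eq, ← sq ‖T * T‖] at this
  have h4' : T * T * (T * T) = (q : ℂ) • (T * T) := by
    rw [← mul_assoc, hcube, smul_mul_assoc]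
  rw [h4', norm_smul, Complex.norm_real, Real.norm_of_nonneg hq0, h2] at h4
  rcases (norm_nonneg T).eq_or_lt with h0 | h0
  · have hT0 : T = 0 := norm_eq_zero.1 h0.symm
    have h1 : (q : ℂ) • a = 0 := by
      have h5 : inner ℂ a (T a) = (q : ℂ) := by
        rw [hTv, inner_sub_right, inner_smul_right, inner_smul_right, haa, hqc]
        ring
      rw [← h5, hT0]
      simp
    have h6 : q = 0 := by
      rcases smul_eq_zero.1 h1 with h | h
      · exact_mod_cast h
      · rw [h, norm_zero] at ha; exact absurd ha zero_ne_one
    rw [← h0, h6, Real.sqrt_zero]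
  · have : ‖T‖ ^ 2 = q := by
      have h7 : 0 < ‖T‖ ^ 2 := by positivity
      nlinarith
    rw [← this, Real.sqrt_sq h0.le]

theorem sqrt_one_sub_norm_inner_sq_le {a b : V} (ha : ‖a‖ = 1) (hb : ‖b‖ = 1) :
    √(1 - ‖inner ℂ a b‖ ^ 2) ≤ ‖a - b‖ := by
  rw [Real.sqrt_le_left (norm_nonneg _), @norm_sub_sq ℂ, ha, hb]
  have h1 := Complex.abs_re_le_norm (inner ℂ a b)
  have h2 : (inner ℂ a b).re ^ 2 ≤ ‖inner ℂ a b‖ ^ 2 := by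
    rw [← sq_abs]; gcongr
  simp only [RCLike.re_to_complex]
  nlinarith [sq_nonneg ((inner ℂ a b).re - 1)]

end PureStates

/-! ### The adiabatic theorem for a gapped family -/

section Adiabatic

variable {V : Type*} [NormedAddCommGroup V] [InnerProductSpace ℂ V]

/-- A dynamical phase: a unimodular solution of `p' = -i e p` for a continuous energy `e`. -/
theorem exists_dynamicalPhase {e : ℝ → ℝ} (he : ContinuousOn e (Ici 0)) {u : ℂ} (hu : ‖u‖ = 1) :
    ∃ p : ℝ → ℂ, p 0 = u ∧ (∀ t, ‖p t‖ = 1) ∧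
      ∀ t, 0 ≤ t → HasDerivWithinAt p (-Complex.I * (e t : ℂ) * p t) (Ici 0) t := by
  have hc : Continuous fun t => e (max t 0) :=
    he.comp_continuous (by fun_prop) fun t => mem_Ici.2 (le_max_right _ _)
  set θ : ℝ → ℝ := fun t => ∫ s in (0 : ℝ)..t, e (max s 0) with hθ
  have hθd : ∀ t, HasDerivAt θ (e (max t 0)) t := fun t =>
    (hc.integral_hasStrictDerivAt 0 t).hasDerivAt
  refine ⟨fun t => u * Complex.exp (((-θ t : ℝ) : ℂ) * Complex.I), ?_, fun t => ?_, fun t ht => ?_⟩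
  · simp [hθ]
  · rw [norm_mul, hu, Complex.norm_exp_ofReal_mul_I, one_mul]
  · have h1 := ((((hθd t).neg.ofReal_comp).mul_const Complex.I).cexp.const_mul u).hasDerivWithinAt
      (s := Ici 0)
    rw [max_eq_left ht] at h1
    refine h1.congr_deriv ?_
    simp only [Pi.neg_apply]
    push_cast
    ring

/-- The adiabatic theorem. With `y = Γ' ζ(Γ)`, where `(H - E) ζ = dφ/dγ`, the vector
`w = p (φ + i y)` solves the Schrödinger equation up to the source term `i p y'`, because the term
`p φ'` produced by the motion of the ground state is cancelled by `i y`. Thus `ψ - w` is bounded by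
its initial value and the integral of `‖y'‖`; the overlap of `w` and `ψ` converges, and `w - p φ`
tends to zero. -/
theorem adiabatic_theorem [FiniteDimensional ℂ V] {A X : V →L[ℂ] V} {I : Set ℝ} {E D : ℝ → ℝ}
    {φ : ℝ → V} (h : IsGappedFamily A X I E D φ) {Γ Γ₁ Γ₂ B B' : ℝ → ℝ} {β : ℝ}
    (hΓ : ∀ t, 0 ≤ t → HasDerivWithinAt Γ (Γ₁ t) (Ici 0) t)
    (hΓ₁ : ∀ t, 0 ≤ t → HasDerivWithinAt Γ₁ (Γ₂ t) (Ici 0) t) (hI : ∀ t, 0 ≤ t → Γ t ∈ I)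
    (hB : ∀ t, 0 ≤ t → HasDerivWithinAt B (B' t) (Ici 0) t)
    (hB' : ∀ t, 0 ≤ t → |Γ₂ t| * (2 * ‖X‖ / D (Γ t) ^ 2)
      + Γ₁ t ^ 2 * (24 * ‖X‖ ^ 2 / D (Γ t) ^ 3) ≤ B' t)
    (hBβ : Tendsto B atTop (𝓝 β))
    (hlim : Tendsto (fun t => |Γ₁ t| * (2 * ‖X‖ / D (Γ t) ^ 2)) atTop (𝓝 0))
    {ψ : ℝ → V} (hψ : ∀ t, 0 ≤ t →
      HasDerivWithinAt ψ (-Complex.I • (A - (Γ t : ℂ) • X) (ψ t)) (Ici 0) t)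
    {u : ℂ} (hu : ‖u‖ = 1) (hψ0 : ψ 0 = u • φ (Γ 0)) :
    ∃ P : ℝ, Tendsto (fun t => √(1 - ‖inner ℂ (φ (Γ t)) (ψ t)‖ ^ 2)) atTop (𝓝 P) ∧
      P ≤ |Γ₁ 0| * (2 * ‖X‖ / D (Γ 0) ^ 2) + (β - B 0) := by
  obtain ⟨χ, ζ, ζ', hζ⟩ := h.exists_corrector
  have hn : ∀ t, 0 ≤ t → ‖φ (Γ t)‖ = 1 := fun t ht => (h.gapped _ (hI t ht)).norm_eq
  have hsymm : ∀ t, 0 ≤ t →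
      (((A - (Γ t : ℂ) • X : V →L[ℂ] V)) : V →ₗ[ℂ] V).IsSymmetric :=
    fun t ht => (h.gapped _ (hI t ht)).symm
  have hψ1 : ∀ t, 0 ≤ t → ‖ψ t‖ = 1 := fun t ht =>
    norm_eq_one_of_schrodinger (T := fun t => A - (Γ t : ℂ) • X) hsymm hψ
      (by rw [hψ0, norm_smul, hu, hn 0 le_rfl, one_mul]) ht
  have hEc : ContinuousOn (fun t => E (Γ t)) (Ici 0) := fun t ht =>
    ((h.hasDerivAt_energy (hI t ht)).continuousAt).comp_continuousWithinAt
      (hΓ t ht).continuousWithinAt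
  obtain ⟨p, hp0, hp1, hpd⟩ := exists_dynamicalPhase hEc hu
  set y : ℝ → V := fun t => Γ₁ t • ζ (Γ t) with hy
  set y' : ℝ → V := fun t => Γ₁ t • (Γ₁ t • ζ' (Γ t)) + Γ₂ t • ζ (Γ t) with hy'
  have hyd : ∀ t, 0 ≤ t → HasDerivWithinAt y (y' t) (Ici 0) t := fun t ht =>
    (hΓ₁ t ht).smul ((hζ _ (hI t ht)).2.1.scomp_hasDerivWithinAt t (hΓ t ht))
  have hφd : ∀ t, 0 ≤ t → HasDerivWithinAt (fun t => φ (Γ t)) (Γ₁ t • χ (Γ t)) (Ici 0) t :=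
    fun t ht => (hζ _ (hI t ht)).1.scomp_hasDerivWithinAt t (hΓ t ht)
  have hyn : ∀ t, 0 ≤ t → ‖y t‖ ≤ |Γ₁ t| * (2 * ‖X‖ / D (Γ t) ^ 2) := fun t ht => by
    rw [hy, norm_smul, Real.norm_eq_abs]
    exact mul_le_mul_of_nonneg_left (hζ _ (hI t ht)).2.2.2.1 (abs_nonneg _)
  have hy'n : ∀ t, 0 ≤ t → ‖y' t‖ ≤ B' t := fun t ht => by
    refine (norm_add_le _ _).trans (le_trans ?_ (hB' t ht))
    rw [norm_smul, norm_smul, norm_smul, Real.norm_eq_abs, Real.norm_eq_abs, ← mul_assoc,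
      ← abs_mul, ← sq, abs_of_nonneg (sq_nonneg (Γ₁ t)), add_comm]
    exact add_le_add (mul_le_mul_of_nonneg_left (hζ _ (hI t ht)).2.2.2.1 (abs_nonneg _))
      (mul_le_mul_of_nonneg_left (hζ _ (hI t ht)).2.2.2.2 (sq_nonneg _))
  set w : ℝ → V := fun t => p t • (φ (Γ t) + Complex.I • y t) with hw
  have hwd : ∀ t, 0 ≤ t → HasDerivWithinAt w (-Complex.I • (A - (Γ t : ℂ) • X) (w t)
      + (Complex.I * p t) • y' t) (Ici 0) t := by
    intro t ht
    have h1 := (hpd t ht).smul ((hφd t ht).add ((hyd t ht).const_smul Complex.I))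
    refine h1.congr_deriv ?_
    have h2 := (h.gapped _ (hI t ht)).eigen
    have h3 : (A - (Γ t : ℂ) • X) (y t) = (E (Γ t) : ℂ) • y t + (Γ₁ t : ℂ) • χ (Γ t) := by
      rw [← (hζ _ (hI t ht)).2.2.1, hy]
      simp only [← Complex.coe_smul, map_smul]
      module
    rw [hw]
    simp only [map_smul, map_add, h2, h3, Pi.add_apply, Pi.smul_apply, ← Complex.coe_smul]
    have hI2 : ∀ z : V, Complex.I • Complex.I • z = -z := fun z => by
      rw [smul_smul, Complex.I_mul_I, neg_one_smul]
    refine sub_eq_zero.1 (Eq.trans (b := p t • (Complex.I • Complex.I • ((Γ₁ t : ℂ) • χ (Γ t))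
      + (Γ₁ t : ℂ) • χ (Γ t))) (by module) (by rw [hI2, neg_add_cancel, smul_zero]))
  have hsrc : ∀ t, 0 ≤ t → ‖(Complex.I * p t) • y' t‖ ≤ B' t := fun t ht => by
    rw [norm_smul, norm_mul, Complex.norm_I, hp1, one_mul, one_mul]
    exact hy'n t ht
  have hvd : ∀ t, 0 ≤ t → HasDerivWithinAt (fun t => w t - ψ t)
      (-Complex.I • (A - (Γ t : ℂ) • X) (w t - ψ t) + (Complex.I * p t) • y' t) (Ici 0) t := by
    intro t ht
    refine ((hwd t ht).sub (hψ t ht)).congr_deriv ?_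
    rw [map_sub]
    module
  have hwφ : ∀ t, w t - p t • φ (Γ t) = (p t * Complex.I) • y t := fun t => by
    rw [hw]
    module
  have hwφn : ∀ t, 0 ≤ t → ‖w t - p t • φ (Γ t)‖ ≤ |Γ₁ t| * (2 * ‖X‖ / D (Γ t) ^ 2) :=
    fun t ht => by
      rw [hwφ, norm_smul, norm_mul, hp1, Complex.norm_I, one_mul, one_mul]
      exact hyn t ht
  have hdist : ∀ t, 0 ≤ t → √(1 - ‖inner ℂ (φ (Γ t)) (ψ t)‖ ^ 2)
      ≤ |Γ₁ t| * (2 * ‖X‖ / D (Γ t) ^ 2) + (|Γ₁ 0| * (2 * ‖X‖ / D (Γ 0) ^ 2) + (B t - B 0)) := by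
    intro t ht
    have h1 := norm_le_of_schrodinger_source (T := fun t => A - (Γ t : ℂ) • X) hsymm hvd hB hsrc ht
    have h2 : ‖w 0 - ψ 0‖ ≤ |Γ₁ 0| * (2 * ‖X‖ / D (Γ 0) ^ 2) := by
      have := hwφn 0 le_rfl
      rwa [hp0, ← hψ0] at this
    have h3 := sqrt_one_sub_norm_inner_sq_le (a := p t • φ (Γ t)) (b := ψ t)
      (by rw [norm_smul, hp1, hn t ht, one_mul]) (hψ1 t ht)
    rw [inner_smul_left, norm_mul, RCLike.norm_conj, hp1, one_mul] at h3
    have h4 : ‖p t • φ (Γ t) - ψ t‖ ≤ ‖w t - p t • φ (Γ t)‖ + ‖w t - ψ t‖ := by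
      rw [norm_sub_rev (w t) (p t • φ (Γ t))]
      exact norm_sub_le_norm_sub_add_norm_sub _ _ _
    linarith [hwφn t ht]
  -- the overlap of `w` and `ψ` is Cauchy
  obtain ⟨z, hz⟩ : ∃ z : ℂ, Tendsto (fun t => inner ℂ (w t) (ψ t)) atTop (𝓝 z) := by
    refine cauchy_map_iff_exists_tendsto.1 (Metric.cauchy_iff.2 ⟨inferInstance, fun ε hε => ?_⟩)
    have hBc : ∀ᶠ t in atTop, dist (B t) β < ε / 2 := hBβ (Metric.ball_mem_nhds _ (by positivity))
    obtain ⟨t₀, ht₀⟩ := eventually_atTop.1 (hBc.and (eventually_ge_atTop 0))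
    refine ⟨(fun t => inner ℂ (w t) (ψ t)) '' Ici t₀, image_mem_map (Ici_mem_atTop t₀), ?_⟩
    have key : ∀ s, t₀ ≤ s → ∀ t, s ≤ t →
        dist (inner ℂ (w t) (ψ t)) (inner ℂ (w s) (ψ s)) < ε := by
      intro s hs t hst
      rw [dist_eq_norm]
      refine (norm_inner_sub_le (T := fun t => A - (Γ t : ℂ) • X) hsymm hwd hψ
        (fun t ht => (hψ1 t ht).le) hB hsrc (ht₀ s hs).2 hst).trans_lt ?_
      have h1 := abs_lt.1 (Real.dist_eq (B s) β ▸ (ht₀ s hs).1)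
      have h2 := abs_lt.1 (Real.dist_eq (B t) β ▸ (ht₀ t (hs.trans hst)).1)
      linarith
    rintro _ ⟨s, hs, rfl⟩ _ ⟨t, ht, rfl⟩
    rcases le_total s t with hst | hst
    · rw [dist_comm]; exact key s hs t hst
    · exact key t ht s hst
  have hz' : Tendsto (fun t => inner ℂ (p t • φ (Γ t)) (ψ t)) atTop (𝓝 z) := by
    have h1 : Tendsto (fun t => inner ℂ (w t - p t • φ (Γ t)) (ψ t)) atTop (𝓝 0) := by
      refine squeeze_zero_norm' ?_ hlim
      filter_upwards [eventually_ge_atTop 0] with t ht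
      refine (norm_inner_le_norm _ _).trans ?_
      rw [hψ1 t ht, mul_one]
      exact hwφn t ht
    have h2 := hz.sub h1
    rw [sub_zero] at h2
    refine h2.congr fun t => ?_
    rw [inner_sub_left, sub_sub_cancel]
  have hP : Tendsto (fun t => √(1 - ‖inner ℂ (φ (Γ t)) (ψ t)‖ ^ 2)) atTop
      (𝓝 (√(1 - ‖z‖ ^ 2))) := by
    have h1 : Tendsto (fun t => √(1 - ‖inner ℂ (p t • φ (Γ t)) (ψ t)‖ ^ 2)) atTop
        (𝓝 (√(1 - ‖z‖ ^ 2))) := ((hz'.norm.pow 2).const_sub 1).sqrt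
    refine h1.congr fun t => ?_
    rw [inner_smul_left, norm_mul, RCLike.norm_conj, hp1, one_mul]
  refine ⟨_, hP, ?_⟩
  have hbound := hlim.add (tendsto_const_nhds (x := |Γ₁ 0| * (2 * ‖X‖ / D (Γ 0) ^ 2)).add
    (hBβ.sub_const (B 0)))
  rw [zero_add] at hbound
  refine le_of_tendsto_of_tendsto hP hbound ?_
  filter_upwards [eventually_ge_atTop 0] with t ht using hdist t ht

end Adiabatic

/-! ### Estimates for the annealing schedule -/

section Schedule

theorem rpow_lt_one_add_inv {c x e : ℝ} (hc : 0 < c) (hx : c ≤ x) (he : -1 ≤ e) (he0 : e ≤ 0) :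
    x ^ e < 1 + 1 / c := by
  have hc' : 0 < 1 / c := by positivity
  rcases le_total 1 x with h | h
  · linarith [Real.rpow_le_one_of_one_le_of_nonpos h he0]
  · have hx0 : 0 < x := hc.trans_le hx
    have h1 := Real.rpow_le_rpow_of_exponent_ge hx0 h he
    rw [Real.rpow_neg_one, ← one_div] at h1
    linarith [one_div_le_one_div_of_le hc hx]

/-- A constant such that `|log x| ≤ logConst l c * x ^ l` for all `x ≥ c`. -/
noncomputable def logConst (l c : ℝ) : ℝ := 1 / l + |Real.log c| / c ^ l

theorem logConst_pos {l : ℝ} (hl : 0 < l) {c : ℝ} (hc : 0 < c) : 0 < logConst l c := by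
  have : 0 < c ^ l := Real.rpow_pos_of_pos hc l
  unfold logConst
  positivity

theorem abs_log_le {l c x : ℝ} (hl : 0 < l) (hc : 0 < c) (hx : c ≤ x) :
    |Real.log x| ≤ logConst l c * x ^ l := by
  have hx0 : 0 < x := hc.trans_le hx
  have hcl : 0 < c ^ l := Real.rpow_pos_of_pos hc l
  have hxl : 0 < x ^ l := Real.rpow_pos_of_pos hx0 l
  have hle : c ^ l ≤ x ^ l := Real.rpow_le_rpow hc.le hx hl.le
  rw [logConst, add_mul]
  rcases le_total 1 x with h | h
  · rw [abs_of_nonneg (Real.log_nonneg h)]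
    have h1 := Real.log_le_rpow_div hx0.le hl
    have h2 : 0 ≤ |Real.log c| / c ^ l * x ^ l := by positivity
    rw [one_div_mul_eq_div]
    linarith
  · have h1 : |Real.log x| ≤ |Real.log c| := by
      rw [abs_of_nonpos (Real.log_nonpos hx0.le h),
        abs_of_nonpos (Real.log_nonpos hc.le (hx.trans h))]
      linarith [Real.log_le_log hc hx]
    have h2 : |Real.log c| ≤ |Real.log c| / c ^ l * x ^ l := by
      rw [div_mul_eq_mul_div, le_div_iff₀ hcl]
      gcongr
    have h3 : 0 ≤ 1 / l * x ^ l := by positivity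
    linarith

/-- The constant in the bound on the first logarithmic derivative of the transverse field. -/
noncomputable def derivConst₁ (l c' c : ℝ) : ℝ := c' * logConst l c + 1

/-- The constant in the bound on the second derivative of the transverse field. -/
noncomputable def derivConst₂ (l c' c : ℝ) : ℝ := derivConst₁ l c' c ^ 2 + 2 * c' / c ^ l + 1

variable {N : ℕ} {L l c' c'' δ c : ℝ} {g g₁ g₂ : ℝ → ℝ}

theorem le_affine (hδ : 0 < δ) {t : ℝ} (ht : 0 ≤ t) : c ≤ δ * t + c := by
  nlinarith [mul_nonneg hδ.le ht]

/-- The first two derivatives of the transverse field, and their decay. -/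
theorem exists_transverseField_derivs (hL : L ≤ 1) (hδ : 0 < δ) (hc : 0 < c) (hl : 0 < l)
    (hc' : 0 < c') (h : AdmissibleExponent N L l c' c'' δ c g g₁ g₂) :
    ∃ Γ₁ Γ₂ : ℝ → ℝ, ∀ t, 0 ≤ t →
      HasDerivWithinAt (transverseField δ c g) (Γ₁ t) (Ici 0) t ∧
      HasDerivWithinAt Γ₁ (Γ₂ t) (Ici 0) t ∧
      |Γ₁ t| ≤ transverseField δ c g t * (derivConst₁ l c' c * δ / (δ * t + c)) ∧
      |Γ₂ t| ≤ transverseField δ c g t * (δ ^ 2 * (derivConst₂ l c' c / (δ * t + c) ^ 2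
        + c'' * (δ * t + c) ^ (-1 - (2 * (N : ℝ) - 1) / (3 * (N : ℝ) - 2)))) := by
  set x : ℝ → ℝ := fun t => δ * t + c with hxdef
  have hcx : ∀ t, 0 ≤ t → c ≤ x t := fun t ht => le_affine hδ ht
  have hx0 : ∀ t, 0 ≤ t → 0 < x t := fun t ht => hc.trans_le (hcx t ht)
  have hxd : ∀ t, HasDerivWithinAt x δ (Ici 0) t := fun t => by
    have h1 := (((hasDerivAt_id' t).const_mul δ).add_const c).hasDerivWithinAt (s := Ici 0)
    rwa [mul_one] at h1
  have hlogd : ∀ t, 0 ≤ t → HasDerivWithinAt (fun t => Real.log (x t)) (δ / x t) (Ici 0) t :=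
    fun t ht => (hxd t).log (hx0 t ht).ne'
  set Γ := transverseField δ c g with hΓ
  have hΓexp : ∀ t, 0 ≤ t → Γ t = Real.exp (Real.log (x t) * -g t) := fun t ht =>
    Real.rpow_def_of_pos (hx0 t ht) _
  have hΓpos : ∀ t, 0 ≤ t → 0 < Γ t := fun t ht => Real.rpow_pos_of_pos (hx0 t ht) _
  -- the logarithmic derivative of `Γ` and its derivative
  set k : ℝ → ℝ := fun t => -(g₁ t * Real.log (x t)) - g t * (δ / x t) with hk
  set k' : ℝ → ℝ := fun t => -(g₂ t * Real.log (x t)) - 2 * (g₁ t * (δ / x t))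
    + g t * (δ ^ 2 / x t ^ 2) with hk'
  have hΓd : ∀ t, 0 ≤ t → HasDerivWithinAt Γ (Γ t * k t) (Ici 0) t := by
    intro t ht
    have h1 := ((hlogd t ht).mul (h.hasDeriv t ht).neg).exp
    have h2 : HasDerivWithinAt Γ _ (Ici 0) t := h1.congr (fun s hs => hΓexp s hs) (hΓexp t ht)
    refine h2.congr_deriv ?_
    simp only [Pi.mul_apply, Pi.neg_apply]
    rw [← hΓexp t ht, hk]
    ring
  have hkd : ∀ t, 0 ≤ t → HasDerivWithinAt k (k' t) (Ici 0) t := by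
    intro t ht
    have h1 := (((h.hasDeriv₂ t ht).mul (hlogd t ht)).neg).sub ((h.hasDeriv t ht).mul
      ((hasDerivWithinAt_const t (Ici 0) δ).div (hxd t) (hx0 t ht).ne'))
    refine h1.congr_deriv ?_
    simp only [hk', Pi.div_apply]
    ring
  refine ⟨fun t => Γ t * k t, fun t => Γ t * (k t ^ 2 + k' t), fun t ht => ⟨hΓd t ht, ?_, ?_, ?_⟩⟩
  · refine ((hΓd t ht).mul (hkd t ht)).congr_deriv ?_
    ring
  all_goals
    have hxt := hx0 t ht
    have hxl : 0 < x t ^ l := Real.rpow_pos_of_pos hxt l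
    have hcl : 0 < c ^ l := Real.rpow_pos_of_pos hc l
    have hg0 := (h.pos t ht).le
    have hg1 : g t ≤ 1 := (h.le t ht).trans hL
    have hlog := abs_log_le hl hc (hcx t ht)
    have hg₁ : |g₁ t| ≤ δ * c' / (x t * x t ^ l) := by
      have := h.bound₁ t ht
      rwa [Real.rpow_add hxt, Real.rpow_one] at this
    have hgk : |g t * (δ / x t)| ≤ δ / x t := by
      rw [abs_mul, abs_of_nonneg hg0, abs_of_pos (by positivity)]
      exact mul_le_of_le_one_left (by positivity) hg1
    have hk1 : |k t| ≤ derivConst₁ l c' c * δ / x t := by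
      have h1 : |g₁ t * Real.log (x t)| ≤ δ * c' / (x t * x t ^ l) * (logConst l c * x t ^ l) := by
        rw [abs_mul]
        gcongr
      have h2 : δ * c' / (x t * x t ^ l) * (logConst l c * x t ^ l)
          = c' * logConst l c * δ / x t := by
        field_simp
      have h3 := abs_sub (-(g₁ t * Real.log (x t))) (g t * (δ / x t))
      rw [abs_neg] at h3
      have h4 : derivConst₁ l c' c * δ / x t = c' * logConst l c * δ / x t + δ / x t := by
        rw [derivConst₁, add_mul, one_mul, add_div]
      rw [h4]
      linarith
  · rw [abs_mul, abs_of_pos (hΓpos t ht)]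
    exact mul_le_mul_of_nonneg_left hk1 (hΓpos t ht).le
  · rw [abs_mul, abs_of_pos (hΓpos t ht)]
    refine mul_le_mul_of_nonneg_left ?_ (hΓpos t ht).le
    have hsq : k t ^ 2 ≤ δ ^ 2 * (derivConst₁ l c' c ^ 2 / x t ^ 2) := by
      have h1 : |k t| ^ 2 ≤ (derivConst₁ l c' c * δ / x t) ^ 2 := by gcongr
      rw [sq_abs] at h1
      refine h1.trans_eq ?_
      rw [div_pow, mul_pow]
      ring
    have hb1 : |g₂ t * Real.log (x t)| ≤ δ ^ 2 * (c'' *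
        x t ^ (-1 - (2 * (N : ℝ) - 1) / (3 * (N : ℝ) - 2))) := by
      rw [abs_mul, ← mul_assoc]
      exact h.bound₂ t ht
    have hb2 : |g₁ t * (δ / x t)| ≤ δ ^ 2 * (c' / c ^ l / x t ^ 2) := by
      rw [abs_mul, abs_of_pos (show 0 < δ / x t by positivity)]
      have h1 : c ^ l ≤ x t ^ l := Real.rpow_le_rpow hc.le (hcx t ht) hl.le
      have h2 : δ * c' / (x t * x t ^ l) ≤ δ * c' / (x t * c ^ l) := by gcongr
      refine (mul_le_mul_of_nonneg_right (hg₁.trans h2) (by positivity)).trans_eq ?_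
      field_simp
    have hb3 : |g t * (δ ^ 2 / x t ^ 2)| ≤ δ ^ 2 * (1 / x t ^ 2) := by
      rw [abs_mul, abs_of_nonneg hg0, abs_of_pos (show 0 < δ ^ 2 / x t ^ 2 by positivity)]
      refine (mul_le_of_le_one_left (by positivity) hg1).trans_eq ?_
      ring
    have hsum : |k t ^ 2 + k' t| ≤ k t ^ 2 + (|g₂ t * Real.log (x t)|
        + 2 * |g₁ t * (δ / x t)| + |g t * (δ ^ 2 / x t ^ 2)|) := by
      have h1 := abs_le.1 (le_refl |g₂ t * Real.log (x t)|)
      have h2 := abs_le.1 (le_refl |g₁ t * (δ / x t)|)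
      have h3 := abs_le.1 (le_refl |g t * (δ ^ 2 / x t ^ 2)|)
      have h4 := sq_nonneg (k t)
      rw [hk', abs_le]
      constructor <;> linarith [h1.1, h1.2, h2.1, h2.2, h3.1, h3.2]
    refine hsum.trans ?_
    have hfin : δ ^ 2 * (derivConst₂ l c' c / x t ^ 2
        + c'' * x t ^ (-1 - (2 * (N : ℝ) - 1) / (3 * (N : ℝ) - 2)))
        = δ ^ 2 * (derivConst₁ l c' c ^ 2 / x t ^ 2) + (δ ^ 2 * (c'' *
          x t ^ (-1 - (2 * (N : ℝ) - 1) / (3 * (N : ℝ) - 2)))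
          + 2 * (δ ^ 2 * (c' / c ^ l / x t ^ 2)) + δ ^ 2 * (1 / x t ^ 2)) := by
      rw [derivConst₂]; ring
    rw [hfin]
    linarith

theorem inv_gapBound_sq_le (hN : 1 ≤ N) (b : ℝ) {γ X : ℝ} (hγ : 0 < γ) (hX : X ≤ N) :
    2 * X / gapBound N b γ ^ 2 ≤ 2 * Real.exp (2 * (b * N)) / (γ ^ N) ^ 2 := by
  have hN0 : (0 : ℝ) < N := by exact_mod_cast hN
  have hD := gapBound_pos hN b hγ
  have hP : 0 < γ ^ N := by positivity
  rw [div_le_div_iff₀ (by positivity) (by positivity)]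
  have h1 : gapBound N b γ ^ 2 = N * Real.exp (-(2 * (b * N))) * (γ ^ N) ^ 2 := by
    rw [gapBound, mul_pow, mul_pow, Real.sq_sqrt hN0.le, ← Real.exp_nat_mul]
    congr 3
    push_cast
    ring
  have h2 : Real.exp (2 * (b * N)) * Real.exp (-(2 * (b * N))) = 1 := by
    rw [← Real.exp_add, add_neg_cancel, Real.exp_zero]
  rw [h1]
  calc 2 * X * (γ ^ N) ^ 2 ≤ 2 * N * (γ ^ N) ^ 2 := by gcongr
    _ = 2 * N * (γ ^ N) ^ 2 * (Real.exp (2 * (b * N)) * Real.exp (-(2 * (b * N)))) := by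
      rw [h2, mul_one]
    _ = _ := by ring

theorem inv_gapBound_cube_le (hN : 1 ≤ N) (b : ℝ) {γ X : ℝ} (hγ : 0 < γ) (hX0 : 0 ≤ X)
    (hX : X ≤ N) : 24 * X ^ 2 / gapBound N b γ ^ 3
      ≤ 24 * (√(N : ℝ) * Real.exp (3 * (b * N))) / (γ ^ N) ^ 3 := by
  have hN0 : (0 : ℝ) < N := by exact_mod_cast hN
  have hD := gapBound_pos hN b hγ
  have hP : 0 < γ ^ N := by positivity
  rw [div_le_div_iff₀ (by positivity) (by positivity)]
  have hs : √(N : ℝ) * √(N : ℝ) = N := Real.mul_self_sqrt hN0.le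
  have h1 : gapBound N b γ ^ 3
      = N * √(N : ℝ) * Real.exp (-(3 * (b * N))) * (γ ^ N) ^ 3 := by
    rw [gapBound, mul_pow, mul_pow, ← Real.exp_nat_mul, pow_succ, sq, hs]
    congr 3
    push_cast
    ring
  have h2 : Real.exp (3 * (b * N)) * Real.exp (-(3 * (b * N))) = 1 := by
    rw [← Real.exp_add, add_neg_cancel, Real.exp_zero]
  rw [h1]
  calc 24 * X ^ 2 * (γ ^ N) ^ 3 ≤ 24 * (N : ℝ) ^ 2 * (γ ^ N) ^ 3 := by gcongr
    _ = 24 * ((√(N : ℝ) * √(N : ℝ)) * N) * (γ ^ N) ^ 3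
        * (Real.exp (3 * (b * N)) * Real.exp (-(3 * (b * N)))) := by
      rw [h2, hs]; ring
    _ = _ := by ring

/-- The powers of the inverse gap are powers of the rescaled time, with exponents controlled
by `L`. -/
theorem transverseField_ratio_le (hc : 0 < c) {x γ a m n : ℝ} (hx : c ≤ x) (ha : 0 ≤ a)
    (haL : a ≤ L) (hγ : γ = x ^ (-a)) (hm : 0 ≤ n - m) (hL : L * (n - m) ≤ 1) :
    γ ^ m / γ ^ n ≤ (1 + 1 / c) * x ^ (L * (n - m)) := by
  have hx0 : 0 < x := hc.trans_le hx
  have hγ0 : 0 < γ := hγ ▸ Real.rpow_pos_of_pos hx0 _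
  have h1 : γ ^ m / γ ^ n = x ^ ((a - L) * (n - m)) * x ^ (L * (n - m)) := by
    rw [← Real.rpow_sub hγ0, hγ, ← Real.rpow_mul hx0.le, ← Real.rpow_add hx0]
    congr 1
    ring
  rw [h1]
  refine mul_le_mul_of_nonneg_right (rpow_lt_one_add_inv hc hx ?_ ?_).le (by positivity)
  · nlinarith [mul_nonneg ha hm]
  · nlinarith

/-- The constant in the bound on the source term of the adiabatic theorem. -/
noncomputable def sourceConst (l c' c'' c : ℝ) : ℝ :=
  24 * derivConst₁ l c' c ^ 2 * (1 + 1 / c) ^ 2 +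
    2 * (1 + 1 / c) * (derivConst₂ l c' c * (1 + 1 / c) + c'')

theorem derivConst₁_pos (hl : 0 < l) (hc : 0 < c) (hc' : 0 < c') : 0 < derivConst₁ l c' c := by
  have := logConst_pos hl hc
  unfold derivConst₁
  positivity

theorem derivConst₂_pos (hc : 0 < c) (hc' : 0 < c') : 0 < derivConst₂ l c' c := by
  have := Real.rpow_pos_of_pos hc l
  unfold derivConst₂
  positivity

theorem sourceConst_pos (hl : 0 < l) (hc : 0 < c) (hc' : 0 < c') (hc'' : 0 < c'') :
    0 < sourceConst l c' c'' c := by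
  have := derivConst₁_pos hl hc hc'
  have := derivConst₂_pos (l := l) hc hc'
  unfold sourceConst
  positivity

theorem slack_pos (hN : 1 ≤ N) (hL : L < 1 / (3 * (N : ℝ) - 2)) :
    0 < 1 - (3 * (N : ℝ) - 2) * L := by
  have hN1 : (1 : ℝ) ≤ N := by exact_mod_cast hN
  rw [lt_div_iff₀ (by linarith)] at hL
  linarith

theorem slack_le_one (hN : 1 ≤ N) (hL0 : 0 < L) : 1 - (3 * (N : ℝ) - 2) * L ≤ 1 := by
  have hN1 : (1 : ℝ) ≤ N := by exact_mod_cast hN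
  have : 0 ≤ (3 * (N : ℝ) - 2) * L := mul_nonneg (by linarith) hL0.le
  linarith

theorem mul_two_mul_sub_one_lt_one (hN : 1 ≤ N) (hL0 : 0 < L)
    (hL : L < 1 / (3 * (N : ℝ) - 2)) : L * (2 * N - 1) < 1 := by
  have hN1 : (1 : ℝ) ≤ N := by exact_mod_cast hN
  nlinarith [slack_pos hN hL]

/-- The exponent `(2N - 1) / (3N - 2)` in the condition on `g''`. -/
noncomputable def exponentRatio (N : ℕ) : ℝ := (2 * (N : ℝ) - 1) / (3 * (N : ℝ) - 2)

theorem exponentRatio_bounds (hN : 1 ≤ N) : 1 / 2 ≤ exponentRatio N ∧ exponentRatio N ≤ 1 := by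
  have hN1 : (1 : ℝ) ≤ N := by exact_mod_cast hN
  have hpos : 0 < 3 * (N : ℝ) - 2 := by linarith
  unfold exponentRatio
  constructor
  · rw [div_le_div_iff₀ two_pos hpos]; linarith
  · rw [div_le_one hpos]; linarith

theorem mul_two_mul_sub_one_eq (hN : 1 ≤ N) (L : ℝ) :
    L * (2 * N - 1) = exponentRatio N - exponentRatio N * (1 - (3 * (N : ℝ) - 2) * L) := by
  have hN1 : (1 : ℝ) ≤ N := by exact_mod_cast hN
  have hpos : 3 * (N : ℝ) - 2 ≠ 0 := by linarith
  have h : exponentRatio N * (3 * (N : ℝ) - 2) = 2 * N - 1 := div_mul_cancel₀ _ hpos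
  linear_combination (-L) * h

end Schedule

section SourceBounds

variable {N : ℕ} {L l c' c'' δ c b X : ℝ} {g g₁ g₂ : ℝ → ℝ}

theorem transverseField_pos (hδ : 0 < δ) (hc : 0 < c) {t : ℝ} (ht : 0 ≤ t) :
    0 < transverseField δ c g t :=
  Real.rpow_pos_of_pos (hc.trans_le (le_affine hδ ht)) _

theorem transverseField_lt (hL : L ≤ 1) (hδ : 0 < δ) (hc : 0 < c)
    (h : AdmissibleExponent N L l c' c'' δ c g g₁ g₂) {t : ℝ} (ht : 0 ≤ t) :
    transverseField δ c g t < 1 + 1 / c :=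
  rpow_lt_one_add_inv hc (le_affine hδ ht) (by linarith [h.le t ht]) (by linarith [h.pos t ht])

/-- The norm of the first-order corrector along the schedule. -/
theorem corrector_bound (hN : 1 ≤ N) (hL0 : 0 < L) (hL : L < 1 / (3 * (N : ℝ) - 2))
    (hδ : 0 < δ) (hc : 0 < c) (hl : 0 < l) (hc' : 0 < c')
    (h : AdmissibleExponent N L l c' c'' δ c g g₁ g₂) (hX : X ≤ N) {t d : ℝ} (ht : 0 ≤ t)
    (hd : |d| ≤ transverseField δ c g t * (derivConst₁ l c' c * δ / (δ * t + c))) :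
    |d| * (2 * X / gapBound N b (transverseField δ c g t) ^ 2)
      ≤ 2 * derivConst₁ l c' c * (1 + 1 / c) * δ * Real.exp (2 * (b * N))
        * (δ * t + c) ^ (L * (2 * N - 1) - 1) := by
  have hx := le_affine (c := c) hδ ht
  have hΓ := transverseField_pos (g := g) hδ hc ht
  set x := δ * t + c with hxdef
  have hx0 : 0 < x := hc.trans_le hx
  set γ := transverseField δ c g t with hγ
  have hN1 : (1 : ℝ) ≤ N := by exact_mod_cast hN
  have hκ := derivConst₁_pos hl hc hc'
  have hratio := transverseField_ratio_le (L := L) (a := g t) (m := 1) (n := 2 * N) hc hx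
    (h.pos t ht).le (h.le t ht) hγ (by linarith)
    (mul_two_mul_sub_one_lt_one hN hL0 hL).le
  have hpow : γ ^ (2 * (N : ℝ)) = (γ ^ N) ^ 2 := by
    rw [← pow_mul, ← Real.rpow_natCast]
    push_cast
    ring_nf
  rw [Real.rpow_one, hpow] at hratio
  have hP : 0 < γ ^ N := by positivity
  calc |d| * (2 * X / gapBound N b γ ^ 2)
      ≤ (γ * (derivConst₁ l c' c * δ / x)) * (2 * Real.exp (2 * (b * N)) / (γ ^ N) ^ 2) :=
        (mul_le_mul_of_nonneg_left (inv_gapBound_sq_le hN b hΓ hX) (abs_nonneg d)).trans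
          (mul_le_mul_of_nonneg_right hd (by positivity))
    _ = 2 * derivConst₁ l c' c * δ * Real.exp (2 * (b * N)) * (γ / (γ ^ N) ^ 2) * x⁻¹ := by
        ring
    _ ≤ 2 * derivConst₁ l c' c * δ * Real.exp (2 * (b * N))
          * ((1 + 1 / c) * x ^ (L * (2 * N - 1))) * x⁻¹ := by gcongr
    _ = _ := by
        rw [Real.rpow_sub hx0, Real.rpow_one]
        ring

/-- The source term of the adiabatic theorem decays fast enough to be integrable in time. -/
theorem source_bound (hN : 1 ≤ N) (hb : 0 < b) (hL0 : 0 < L) (hL : L < 1 / (3 * (N : ℝ) - 2))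
    (hδ : 0 < δ) (hc : 0 < c) (hl : 0 < l) (hc' : 0 < c') (hc'' : 0 < c'')
    (h : AdmissibleExponent N L l c' c'' δ c g g₁ g₂) (hX0 : 0 ≤ X) (hX : X ≤ N) {t d₁ d₂ : ℝ}
    (ht : 0 ≤ t)
    (hd₁ : |d₁| ≤ transverseField δ c g t * (derivConst₁ l c' c * δ / (δ * t + c)))
    (hd₂ : |d₂| ≤ transverseField δ c g t * (δ ^ 2 * (derivConst₂ l c' c / (δ * t + c) ^ 2
        + c'' * (δ * t + c) ^ (-1 - (2 * (N : ℝ) - 1) / (3 * (N : ℝ) - 2))))) :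
    |d₂| * (2 * X / gapBound N b (transverseField δ c g t) ^ 2)
      + d₁ ^ 2 * (24 * X ^ 2 / gapBound N b (transverseField δ c g t) ^ 3)
      ≤ sourceConst l c' c'' c * δ ^ 2 * (√(N : ℝ) * Real.exp (3 * (b * N)))
        * (δ * t + c) ^ (-1 - exponentRatio N * (1 - (3 * (N : ℝ) - 2) * L)) := by
  have hx := le_affine (c := c) hδ ht
  have hΓ := transverseField_pos (g := g) hδ hc ht
  set x := δ * t + c with hxdef
  have hx0 : 0 < x := hc.trans_le hx
  set γ := transverseField δ c g t with hγ
  have hN1 : (1 : ℝ) ≤ N := by exact_mod_cast hN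
  have hκ₁ := derivConst₁_pos hl hc hc'
  have hκ₂ := derivConst₂_pos (l := l) hc hc'
  set M := 1 + 1 / c with hM
  have hM0 : 0 < M := by positivity
  set S := 1 - (3 * (N : ℝ) - 2) * L with hS
  have hS0 : 0 < S := slack_pos hN hL
  have hS1 : S ≤ 1 := slack_le_one hN hL0
  set r := exponentRatio N with hr
  obtain ⟨hr1, hr2⟩ := exponentRatio_bounds hN
  rw [← hr] at hr1 hr2
  have hrL : L * (2 * N - 1) = r - r * S := mul_two_mul_sub_one_eq hN L
  set Z := √(N : ℝ) * Real.exp (3 * (b * N)) with hZ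
  have hP : 0 < γ ^ N := by positivity
  have hexp : Real.exp (2 * (b * N)) ≤ Z := by
    have h1 : (1 : ℝ) ≤ √(N : ℝ) := Real.one_le_sqrt.2 hN1
    have h2 : Real.exp (2 * (b * N)) ≤ Real.exp (3 * (b * N)) := by
      apply Real.exp_le_exp.2
      have : 0 < b * N := by positivity
      linarith
    calc Real.exp (2 * (b * N)) ≤ 1 * Real.exp (3 * (b * N)) := by rwa [one_mul]
      _ ≤ Z := by rw [hZ]; gcongr
  have hZ0 : 0 < Z := (Real.exp_pos _).trans_le hexp
  have hM1 : ∀ e : ℝ, -1 ≤ e → e ≤ 0 → x ^ e ≤ M := fun e h1 h2 =>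
    (rpow_lt_one_add_inv hc hx h1 h2).le
  have hratio₂ : γ / (γ ^ N) ^ 2 ≤ M * x ^ (r - r * S) := by
    have h1 := transverseField_ratio_le (L := L) (a := g t) (m := 1) (n := 2 * N) hc hx
      (h.pos t ht).le (h.le t ht) hγ (by linarith) (mul_two_mul_sub_one_lt_one hN hL0 hL).le
    have hpow : γ ^ (2 * (N : ℝ)) = (γ ^ N) ^ 2 := by
      rw [← pow_mul, ← Real.rpow_natCast]
      push_cast
      ring_nf
    rwa [Real.rpow_one, hpow, hrL] at h1
  have hratio₃ : γ ^ 2 / (γ ^ N) ^ 3 ≤ M * x ^ (1 - S) := by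
    have h1 := transverseField_ratio_le (L := L) (a := g t) (m := 2) (n := 3 * N) hc hx
      (h.pos t ht).le (h.le t ht) hγ (by linarith) (by rw [mul_comm]; linarith)
    have hpow : γ ^ (3 * (N : ℝ)) = (γ ^ N) ^ 3 := by
      rw [← pow_mul, ← Real.rpow_natCast]
      push_cast
      ring_nf
    rwa [Real.rpow_two, hpow, show L * (3 * (N : ℝ) - 2) = 1 - S by rw [hS]; ring] at h1
  have hpart₁ : d₁ ^ 2 * (24 * X ^ 2 / gapBound N b γ ^ 3)
      ≤ 24 * derivConst₁ l c' c ^ 2 * M ^ 2 * δ ^ 2 * Z * x ^ (-1 - r * S) := by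
    have hd : d₁ ^ 2 ≤ (γ * (derivConst₁ l c' c * δ / x)) ^ 2 := by
      rw [← sq_abs]; gcongr
    calc d₁ ^ 2 * (24 * X ^ 2 / gapBound N b γ ^ 3)
        ≤ (γ * (derivConst₁ l c' c * δ / x)) ^ 2 * (24 * Z / (γ ^ N) ^ 3) :=
          (mul_le_mul_of_nonneg_left (inv_gapBound_cube_le hN b hΓ hX0 hX) (sq_nonneg _)).trans
            (mul_le_mul_of_nonneg_right hd (by positivity))
      _ = 24 * derivConst₁ l c' c ^ 2 * δ ^ 2 * Z * (γ ^ 2 / (γ ^ N) ^ 3) * (x ^ 2)⁻¹ := by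
          ring_nf
      _ ≤ 24 * derivConst₁ l c' c ^ 2 * δ ^ 2 * Z * (M * x ^ (1 - S)) * (x ^ 2)⁻¹ := by gcongr
      _ = 24 * derivConst₁ l c' c ^ 2 * δ ^ 2 * Z * M
            * (x ^ (-1 - r * S) * x ^ (-((1 - r) * S))) := by
          rw [← Real.rpow_add hx0, show -1 - r * S + -((1 - r) * S) = (1 - S) - 2 by ring,
            Real.rpow_sub hx0 (1 - S) 2, Real.rpow_two]
          ring
      _ ≤ 24 * derivConst₁ l c' c ^ 2 * δ ^ 2 * Z * M * (x ^ (-1 - r * S) * M) := by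
          gcongr
          apply hM1 <;> nlinarith
      _ = _ := by ring
  have hpart₂ : |d₂| * (2 * X / gapBound N b γ ^ 2)
      ≤ 2 * M * (derivConst₂ l c' c * M + c'') * δ ^ 2 * Z * x ^ (-1 - r * S) := by
    have hinner : x ^ (r - r * S) * (derivConst₂ l c' c / x ^ 2 + c'' * x ^ (-1 - r))
        ≤ (derivConst₂ l c' c * M + c'') * x ^ (-1 - r * S) := by
      have h1 : x ^ (r - r * S) / x ^ 2 ≤ M * x ^ (-1 - r * S) := by
        have h2 : x ^ (r - r * S) / x ^ 2 = x ^ (-(1 - r)) * x ^ (-1 - r * S) := by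
          rw [← Real.rpow_two, ← Real.rpow_sub hx0, ← Real.rpow_add hx0]
          congr 1
          ring
        rw [h2]
        gcongr
        apply hM1 <;> linarith
      have h3 : x ^ (r - r * S) * x ^ (-1 - r) = x ^ (-1 - r * S) := by
        rw [← Real.rpow_add hx0]
        congr 1
        ring
      calc x ^ (r - r * S) * (derivConst₂ l c' c / x ^ 2 + c'' * x ^ (-1 - r))
          = derivConst₂ l c' c * (x ^ (r - r * S) / x ^ 2)
            + c'' * (x ^ (r - r * S) * x ^ (-1 - r)) := by ring
        _ ≤ derivConst₂ l c' c * (M * x ^ (-1 - r * S)) + c'' * x ^ (-1 - r * S) := by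
            rw [h3]; gcongr
        _ = _ := by ring
    calc |d₂| * (2 * X / gapBound N b γ ^ 2)
        ≤ (γ * (δ ^ 2 * (derivConst₂ l c' c / x ^ 2 + c'' * x ^ (-1 - r))))
            * (2 * Real.exp (2 * (b * N)) / (γ ^ N) ^ 2) :=
          (mul_le_mul_of_nonneg_left (inv_gapBound_sq_le hN b hΓ hX) (abs_nonneg _)).trans
            (mul_le_mul_of_nonneg_right hd₂ (by positivity))
      _ = 2 * δ ^ 2 * Real.exp (2 * (b * N)) * ((γ / (γ ^ N) ^ 2)
            * (derivConst₂ l c' c / x ^ 2 + c'' * x ^ (-1 - r))) := by ring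
      _ ≤ 2 * δ ^ 2 * Z * ((M * x ^ (r - r * S))
            * (derivConst₂ l c' c / x ^ 2 + c'' * x ^ (-1 - r))) := by gcongr
      _ = 2 * δ ^ 2 * Z * M * (x ^ (r - r * S)
            * (derivConst₂ l c' c / x ^ 2 + c'' * x ^ (-1 - r))) := by ring
      _ ≤ 2 * δ ^ 2 * Z * M * ((derivConst₂ l c' c * M + c'') * x ^ (-1 - r * S)) := by gcongr
      _ = _ := by ring
  refine (add_le_add hpart₂ hpart₁).trans_eq ?_
  rw [sourceConst, ← hM]
  ring

end SourceBounds

/-! ### Slow annealing -/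

section Annealing

variable {N : ℕ} {C c : ℝ} {J : Finset (Fin N) → ℝ}

/-- The transverse-field Ising Hamiltonians form a gapped family, with nonnegative ground
states. -/
theorem exists_isGappedFamily (hN : 1 ≤ N) (hC : 0 < C) {M : ℝ} (hM : 1 ≤ M)
    (hJ : ‖isingHamiltonian J‖ ≤ C * N) :
    ∃ (E : ℝ → ℝ) (φ : ℝ → SpinSpace N),
      IsGappedFamily (isingHamiltonian J) (transverse N) (Ioo 0 M) E
        (gapBound N (gapRate C M)) φ ∧
      ∀ γ ∈ Ioo 0 M, IsGroundState (hamiltonian J γ) (E γ) (φ γ) := by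
  choose! E φ hφ hnn using fun (γ : ℝ) (hγ : γ ∈ Ioo 0 M) =>
    exists_isGroundState_nonneg hN hC hM hJ hγ.1 hγ.2.le
  refine ⟨E, φ, ⟨isOpen_Ioo, ?_, fun γ hγ => ?_, fun γ _ => ?_, fun γ hγ γ' hγ' => ?_⟩, hφ⟩
  · intro v w
    have h0 := hamiltonian_isSymmetric J 0 v w
    have h1 := hamiltonian_isSymmetric J 1 v w
    simp only [ContinuousLinearMap.coe_coe, hamiltonian_eq, sub_apply, smul_apply, inner_sub_left,
      inner_sub_right, Complex.ofReal_zero, zero_smul, sub_zero,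
      Complex.ofReal_one, one_smul] at h0 h1 ⊢
    rw [h0] at h1
    exact sub_right_injective h1
  · exact ⟨hamiltonian_isSymmetric J γ, (hφ γ hγ).1, (hφ γ hγ).2.1, gapBound_pos hN _ hγ.1,
      fun y hy => coercive_hamiltonian hN hC hM hJ hγ.1 hγ.2.le (hφ γ hγ) hy⟩
  · unfold gapBound
    fun_prop
  · have h1 : inner ℂ (φ γ) (φ γ') = ((∑ s, ‖φ γ s‖ * ‖φ γ' s‖ : ℝ) : ℂ) := by
      rw [PiLp.inner_apply, Complex.ofReal_sum]
      refine Finset.sum_congr rfl fun s _ => ?_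
      rw [RCLike.inner_apply, hnn γ hγ s, hnn γ' hγ' s]
      simp [mul_comm]
    rw [h1, Complex.norm_real, Real.norm_of_nonneg (Finset.sum_nonneg fun s _ => by positivity)]

end Annealing

end QuantumAnnealing

open QuantumAnnealing

theorem theorem1 :
    -- energy scale per spin and offset of the schedule
    ∀ C c : ℝ, 0 < C → 0 < c →
    -- constants of the gap bound: independent of `N` and of everything below
    ∃ a b : ℝ, 0 < a ∧ 0 < b ∧
    ∀ l c' c'' : ℝ, 0 < l → 0 < c' → 0 < c'' →
    ∃ κ : ℝ, 0 < κ ∧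
    ∀ (N : ℕ), 1 ≤ N →
    ∀ (J : Finset (Fin N) → ℝ), ‖QuantumAnnealing.isingHamiltonian J‖ ≤ C * N →
    ∀ (L : ℝ), 0 < L → L < 1 / (3 * (N : ℝ) - 2) →
    ∀ (δ : ℝ), 0 < δ →
    ∀ (g g₁ g₂ : ℝ → ℝ), QuantumAnnealing.AdmissibleExponent N L l c' c'' δ c g g₁ g₂ →
    ∀ (Γ : ℝ → ℝ), Γ = QuantumAnnealing.transverseField δ c g →
      -- the gap bound, which fixes the meaning of `b`
      (∀ t : ℝ, 0 ≤ t → a * √(N : ℝ) * Real.exp (-(b * N)) * Γ t ^ N ≤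
        QuantumAnnealing.energyGap (QuantumAnnealing.hamiltonian J (Γ t))) ∧
      -- instantaneous ground states `φ t` and the running state `ψ t`
      ∀ (E : ℝ → ℝ) (φ ψ : ℝ → QuantumAnnealing.SpinSpace N),
        (∀ t : ℝ, 0 ≤ t → QuantumAnnealing.IsGroundState
          (QuantumAnnealing.hamiltonian J (Γ t)) (E t) (φ t)) →
        QuantumAnnealing.SolvesSchrodinger (fun t => QuantumAnnealing.hamiltonian J (Γ t)) ψ →
        QuantumAnnealing.IsGroundState (QuantumAnnealing.hamiltonian J (Γ 0)) (E 0) (ψ 0) →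
        ∃ P : ℝ,
          Tendsto (fun t : ℝ => ‖QuantumAnnealing.proj (ψ t) - QuantumAnnealing.proj (φ t)‖)
            atTop (𝓝 P) ∧
          ∀ ε : ℝ, 0 < ε →
            δ ≤ κ * ε * (1 - (3 * (N : ℝ) - 2) * L) *
              ((N : ℝ) ^ (-(1 / 2 : ℝ)) * Real.exp (-(3 * b * N))) →
            P ≤ ε := by
  intro C c hC hc
  set M : ℝ := 1 + 1 / c with hM
  have hM1 : 1 ≤ M := by
    have : 0 < 1 / c := by positivity
    linarith
  have hM0 : 0 < M := by linarith
  have hb := gapRate_pos hC hM1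
  set b := gapRate C M with hbdef
  refine ⟨1, b, one_pos, hb, ?_⟩
  intro l c' c'' hl hc' hc''
  have hκ₁ := derivConst₁_pos hl hc hc'
  have hK := sourceConst_pos hl hc hc' hc''
  set κ₁ := derivConst₁ l c' c with hκ₁def
  set K := sourceConst l c' c'' c with hKdef
  refine ⟨(2 * κ₁ * M ^ 2 + 2 * K * M)⁻¹, by positivity, ?_⟩
  rintro N hN J hJ L hL0 hL δ hδ g g₁ g₂ hg Γ rfl
  have hN1 : (1 : ℝ) ≤ N := by exact_mod_cast hN
  have hL1 : L ≤ 1 := by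
    refine hL.le.trans ?_
    rw [div_le_one (by linarith)]
    linarith
  have hmem : ∀ t, 0 ≤ t → transverseField δ c g t ∈ Ioo 0 M := fun t ht =>
    ⟨transverseField_pos hδ hc ht, transverseField_lt hL1 hδ hc hg ht⟩
  refine ⟨fun t ht => ?_, ?_⟩
  · rw [one_mul]
    exact gapBound_le_energyGap hN hC hM1 hJ (hmem t ht).1 (hmem t ht).2.le
  intro E φ ψ hφ hψ hψ0
  obtain ⟨E', φ', hfam, hgs⟩ := exists_isGappedFamily hN hC hM1 hJ
  obtain ⟨Γ₁, Γ₂, hΓ⟩ := exists_transverseField_derivs hL1 hδ hc hl hc' hg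
  obtain ⟨-, u, hu, hu0⟩ := (hgs _ (hmem 0 le_rfl)).exists_eq_smul hN hC hM1 hJ
    (hmem 0 le_rfl).1 (hmem 0 le_rfl).2.le hψ0
  set S := 1 - (3 * (N : ℝ) - 2) * L with hS
  have hS0 : 0 < S := slack_pos hN hL
  have hS1 : S ≤ 1 := slack_le_one hN hL0
  obtain ⟨hr1, hr2⟩ := exponentRatio_bounds hN
  set r := exponentRatio N with hr
  have hrS : 0 < r * S := by positivity
  set Z := √(N : ℝ) * Real.exp (3 * (b * N)) with hZ
  have hZ0 : 0 < Z := by positivity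
  have hxpos : ∀ t, 0 ≤ t → 0 < δ * t + c := fun t ht => hc.trans_le (le_affine hδ ht)
  have hxlim : Tendsto (fun t => δ * t + c) atTop atTop :=
    tendsto_atTop_add_const_right _ c (tendsto_id.const_mul_atTop hδ)
  -- a primitive of the bound on the source term
  set B : ℝ → ℝ := fun t => -(K * δ * Z / (r * S)) * (δ * t + c) ^ (-(r * S)) with hB
  have hBd : ∀ t, 0 ≤ t →
      HasDerivWithinAt B (K * δ ^ 2 * Z * (δ * t + c) ^ (-1 - r * S)) (Ici 0) t := by
    intro t ht
    have h1 : HasDerivAt (fun t => δ * t + c) δ t := by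
      have := ((hasDerivAt_id' t).const_mul δ).add_const c
      rwa [mul_one] at this
    have h2 := ((h1.rpow_const (p := -(r * S)) (Or.inl (hxpos t ht).ne')).const_mul
      (-(K * δ * Z / (r * S)))).hasDerivWithinAt (s := Ici 0)
    refine h2.congr_deriv ?_
    rw [show -(r * S) - 1 = -1 - r * S by ring]
    field_simp
  have hBlim : Tendsto B atTop (𝓝 0) := by
    have := ((tendsto_rpow_neg_atTop hrS).comp hxlim).const_mul (-(K * δ * Z / (r * S)))
    rwa [mul_zero] at this
  have hcorr : ∀ t : ℝ, 0 ≤ t → _ := fun t ht =>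
    corrector_bound (b := b) (X := ‖transverse N‖) hN hL0 hL hδ hc hl hc' hg
      norm_transverse_le ht (hΓ t ht).2.2.1
  have hexpo := mul_two_mul_sub_one_lt_one hN hL0 hL
  have hlim : Tendsto (fun t => |Γ₁ t| * (2 * ‖transverse N‖ /
      gapBound N b (transverseField δ c g t) ^ 2)) atTop (𝓝 0) := by
    have h1 : Tendsto (fun t => 2 * κ₁ * M * δ * Real.exp (2 * (b * N))
        * (δ * t + c) ^ (L * (2 * N - 1) - 1)) atTop (𝓝 0) := by
      have := ((tendsto_rpow_neg_atTop (sub_pos.2 hexpo)).comp hxlim).const_mul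
        (2 * κ₁ * M * δ * Real.exp (2 * (b * N)))
      simpa using this
    refine squeeze_zero' (Eventually.of_forall fun t => by positivity) ?_ h1
    filter_upwards [eventually_ge_atTop 0] with t ht using hcorr t ht
  obtain ⟨P, hP, hPle⟩ := adiabatic_theorem hfam (fun t ht => (hΓ t ht).1)
    (fun t ht => (hΓ t ht).2.1) hmem hBd (fun t ht => source_bound hN hb hL0 hL hδ hc hl hc' hc''
      hg (norm_nonneg _) norm_transverse_le ht (hΓ t ht).2.2.1 (hΓ t ht).2.2.2) hBlim hlim
    (fun t ht => hψ t ht) hu hu0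
  have hψ1 : ∀ t, 0 ≤ t → ‖ψ t‖ = 1 := fun t ht =>
    norm_eq_one_of_schrodinger (T := fun t => hamiltonian J (transverseField δ c g t))
      (fun t _ => hamiltonian_isSymmetric J _) (fun t ht => hψ t ht) hψ0.1 ht
  refine ⟨P, hP.congr' ?_, fun ε hε hδε => hPle.trans ?_⟩
  · -- the given ground states differ from the nonnegative ones by phases
    filter_upwards [eventually_ge_atTop 0] with t ht
    obtain ⟨-, v, hv, hv0⟩ := (hgs _ (hmem t ht)).exists_eq_smul hN hC hM1 hJ
      (hmem t ht).1 (hmem t ht).2.le (hφ t ht)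
    rw [norm_sub_rev, proj, proj, norm_rankOne_sub_rankOne (hφ t ht).1 (hψ1 t ht), hv0,
      inner_smul_left, norm_mul, RCLike.norm_conj, hv, one_mul]
  · have h0 := hcorr 0 le_rfl
    rw [mul_zero, zero_add] at h0
    have hcpow : ∀ e : ℝ, -1 ≤ e → e ≤ 0 → c ^ e ≤ M := fun e h1 h2 =>
      (rpow_lt_one_add_inv hc le_rfl h1 h2).le
    have hexpZ : Real.exp (2 * (b * N)) ≤ Z / S := by
      rw [le_div_iff₀ hS0]
      have h1 : (1 : ℝ) ≤ √(N : ℝ) := Real.one_le_sqrt.2 hN1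
      have h2 : Real.exp (2 * (b * N)) ≤ Real.exp (3 * (b * N)) := by
        apply Real.exp_le_exp.2
        have : 0 < b * N := by positivity
        linarith
      calc Real.exp (2 * (b * N)) * S ≤ Real.exp (3 * (b * N)) * 1 := by gcongr
        _ = 1 * Real.exp (3 * (b * N)) := by ring
        _ ≤ Z := by rw [hZ]; gcongr
    have hfirst : 2 * κ₁ * M * δ * Real.exp (2 * (b * N)) * c ^ (L * (2 * N - 1) - 1)
        ≤ 2 * κ₁ * M * δ * (Z / S) * M := by
      have : 0 ≤ L * (2 * N - 1) := mul_nonneg hL0.le (by linarith)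
      gcongr
      exact hcpow _ (by linarith) (by linarith)
    have hsecond : 0 - B 0 ≤ 2 * K * M * δ * (Z / S) := by
      have h1 : 0 - B 0 = K * δ * (Z / S) * (1 / r) * c ^ (-(r * S)) := by
        simp only [hB, mul_zero, zero_add]
        field_simp
        ring
      have h2 : 1 / r ≤ 2 := by
        rw [div_le_iff₀ (by linarith)]; linarith
      calc 0 - B 0 = K * δ * (Z / S) * (1 / r) * c ^ (-(r * S)) := h1
        _ ≤ K * δ * (Z / S) * 2 * M := by
            gcongr
            exact hcpow _ (by nlinarith) (by linarith)
        _ = _ := by ring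
    have hZinv : Z * ((N : ℝ) ^ (-(1 / 2 : ℝ)) * Real.exp (-(3 * b * N))) = 1 := by
      rw [hZ, Real.sqrt_eq_rpow, mul_mul_mul_comm, ← Real.rpow_add (by linarith), ← Real.exp_add]
      simp [mul_assoc]
    have htotal : δ * (Z / S) * (2 * κ₁ * M ^ 2 + 2 * K * M) ≤ ε := by
      have hpos : 0 < 2 * κ₁ * M ^ 2 + 2 * K * M := by positivity
      calc δ * (Z / S) * (2 * κ₁ * M ^ 2 + 2 * K * M)
          ≤ ((2 * κ₁ * M ^ 2 + 2 * K * M)⁻¹ * ε * S *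
            ((N : ℝ) ^ (-(1 / 2 : ℝ)) * Real.exp (-(3 * b * N)))) * (Z / S)
              * (2 * κ₁ * M ^ 2 + 2 * K * M) := by gcongr
        _ = ((2 * κ₁ * M ^ 2 + 2 * K * M)⁻¹ * (2 * κ₁ * M ^ 2 + 2 * K * M)) * ε * (S / S)
              * (Z * ((N : ℝ) ^ (-(1 / 2 : ℝ)) * Real.exp (-(3 * b * N)))) := by ring
        _ = ε := by
            rw [hZinv, inv_mul_cancel₀ hpos.ne', div_self hS0.ne']
            ring
    linarith
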